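/- Let $\Gamma$ be a finite alphabet, $\Gamma^*$ the set of finite words (with empty word $1$) and $\Gamma^\infty$ the set of finite and infinite words over $\Gamma$. For $K\subseteq\Gamma^*$ let $K^\omega\subseteq\Gamma^\infty$ be the set of all infinite concatenations $u_0u_1u_2\cdots$ with $u_i\in K$ (in particular $1^\omega=1$). For a homomorphism $h:\Gamma^*\to M$ to a monoid, write $[s]=h^{-1}(s)$ for $s \in M$; a pair $(s,e)\in M\times M$ is a linked pair if $e^2=e$ and $se=s$. The homomorphism $h$ recognizes $L\subseteq\Gamma^\infty$ if $L$ is the union of all $[s][e]^\omega$ over the linked pairs $(s,e)$ with $[s][e]^\omega\cap L\neq\emptyset$, and $L$ is $\omega$-regular if it is recognized by a homomorphism to a finite monoid. The syntactic monoid $\mathrm{Synt}(L)$ is $\Gamma^*/{\approx_L}$, where $u\approx_L v$ if for all $x,y,z\in\Gamma^*$ both $xuyz^\omega\in L\Leftrightarrow xvyz^\omega\in L$ and $x(uy)^\omega\in L\Leftrightarrow x(vy)^\omega\in L$; the syntactic homomorphism is the canonical map $\Gamma^*\to\mathrm{Synt}(L)$. First-order formulas are interpreted over the positions of a word, with the predicates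 $x<y$ and $\lambda(x)=a$ (the letter at position $x$ is $a$) for $a\in\Gamma$. $\Sigma_2$ is the set of formulas in prenex normal form with a block of existential quantifiers followed by a block of universal quantifiers, where a block may be empty; $\mathbb{B}\Sigma_2$ is the set of Boolean combinations of $\Sigma_2$-sentences. Let $\mathbf{V}_2$ be the pseudovariety of finite monoids that corresponds to $\mathbb{B}\Sigma_2$ over finite words: it consists of the finite monoids that divide (i.e. are a homomorphic image of a submonoid of) a finite direct product of syntactic monoids, in the usual sense for languages of finite words, of $\mathbb{B}\Sigma_2$-definable languages $K\subseteq A^*$, where $A$ ranges over the finite alphabets. **Theorem.** Let $L\subseteq\Gamma^\infty$ be $\omega$-regular. Then the following are equivalent: 1. $L$ is a finite Boolean combination of monomials, i.e. of languages $A_0^*a_1A_1^*a_2\cdots A_{n-1}^*a_nA_n^\infty\subseteq\Gamma^\infty$ with $n\geq 0$, $a_i\in\Gamma$ and $A_i\subseteq\Gamma$. 2. $L$ is definable in $\mathbb{B}\Sigma_2$. 3. The syntactic homomorphism $h:\Gamma^*\to\mathrm{Synt}(L)$ of $L$ satisfies: (a) $\mathrm{Synt}(L)\in\mathbf{V}_2$;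 and (b) for all linked pairs $(s,e),(t,f)$ of $\mathrm{Synt}(L)$: if there are a set $C\subseteq\Gamma$ and words $\hat e,\hat f\in\Gamma^*$ such that $h(\hat e)=e$, $h(\hat f)=f$, the set of letters of $\hat e$ and the set of letters of $\hat f$ are both equal to $C$, and $s\cdot h(C^*)=t\cdot h(C^*)$, then $[s][e]^\omega\subseteq L\Leftrightarrow[t][f]^\omega\subseteq L$. -/

import Mathlib

namespace OmegaWords

universe u v w

/-! ### Finite and infinite words -/

/-- The set `Γ^∞` of finite and infinite words over `Γ`; finite words are the elements of
the free monoid `Γ^* = FreeMonoid Γ`. -/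
inductive Word (Γ : Type u) : Type u
  | fin (w : FreeMonoid Γ) : Word Γ
  | inf (s : Stream' Γ) : Word Γ

namespace Word

variable {Γ : Type u}

/-- Concatenation `u α` of a finite word with a finite or infinite word. -/
def append (p : FreeMonoid Γ) : Word Γ → Word Γ
  | fin w => fin (p * w)
  | inf s => inf (p.toList ++ₛ s)

/-- The free monoid acts on `Γ^∞` by concatenation on the left: `p • α` is the word `p α`. -/
instance : MulAction (FreeMonoid Γ) (Word Γ) where
  smul := append
  one_smul := by
    rintro (w | s)
    · exact congrArg fin (one_mul w)
    · rfl
  mul_smul := by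
    rintro p q (w | s)
    · exact congrArg fin (mul_assoc p q w)
    · exact congrArg inf (Stream'.append_append_stream p.toList q.toList s)

/-- The letter at position `i`, if `i` is a position of the word. -/
def get? : Word Γ → ℕ → Option Γ
  | fin w, i => w.toList[i]?
  | inf s, i => some (s.get i)

/-- The positions of a word: `0, …, |α| - 1`, respectively all natural numbers. -/
def Pos (α : Word Γ) : Type := {i : ℕ // (α.get? i).isSome}

end Word

/-- The alphabet of a finite word: the set of letters that occur in it. -/
def alph {Γ : Type u} (p : FreeMonoid Γ) : Set Γ := {a | a ∈ p}

/-- `A^*` for a set of letters `A`. -/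
def starOf {Γ : Type u} (A : Set Γ) : Set (FreeMonoid Γ) := {p | alph p ⊆ A}

/-- `A^∞` for a set of letters `A`. -/
def inftyOf {Γ : Type u} (A : Set Γ) : Set (Word Γ) :=
  {α | ∀ (i : ℕ) (a : Γ), α.get? i = some a → a ∈ A}

/-- The concatenation `K L` of `K ⊆ Γ^*` and `L ⊆ Γ^∞`. -/
def concat {Γ : Type u} (K : Set (FreeMonoid Γ)) (L : Set (Word Γ)) : Set (Word Γ) :=
  {α | ∃ p ∈ K, ∃ β ∈ L, α = p • β}

/-- `α` is the infinite concatenation `u₀ u₁ u₂ ⋯`: every finite product `u₀ ⋯ uₙ₋₁` is a prefix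
of `α`, and every position of `α` is covered by such a prefix. (If almost all `uᵢ` are empty
then `α` is a finite word.) -/
def IsInfiniteConcat {Γ : Type u} (u : ℕ → FreeMonoid Γ) (α : Word Γ) : Prop :=
  (∀ n : ℕ, ∃ β : Word Γ, α = ((List.range n).map u).prod • β) ∧
    ∀ i : ℕ, (α.get? i).isSome → ∃ n : ℕ, i < ((List.range n).map u).prod.length

/-- `K^ω`: the words that are an infinite concatenation of words in `K`. -/
def omegaPow {Γ : Type u} (K : Set (FreeMonoid Γ)) : Set (Word Γ) :=
  {α | ∃ u : ℕ → FreeMonoid Γ, (∀ i, u i ∈ K) ∧ IsInfiniteConcat u α}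

open Classical in
/-- The word `z^ω = z z z ⋯`; here `1^ω = 1`. -/
noncomputable def omegaWord {Γ : Type u} (z : FreeMonoid Γ) : Word Γ :=
  if h : z.toList = [] then Word.fin 1 else Word.inf (Stream'.cycle z.toList h)

/-! ### Recognition by monoids, regular languages -/

/-- `(s, e)` is a linked pair: `e` is idempotent and `s e = s`. -/
def IsLinkedPair {M : Type v} [Monoid M] (s e : M) : Prop := e * e = e ∧ s * e = s

/-- The language `[s][e]^ω`, where `[x] = h⁻¹(x)`. -/
def pairLang {Γ : Type u} {M : Type v} [Monoid M] (h : FreeMonoid Γ →* M) (s e : M) :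
    Set (Word Γ) :=
  concat (h ⁻¹' {s}) (omegaPow (h ⁻¹' {e}))

/-- `h` recognizes `L`: `L` is the union of all `[s][e]^ω` over the linked pairs `(s, e)` for which
`[s][e]^ω` meets `L`. -/
def Recognizes {Γ : Type u} {M : Type v} [Monoid M] (h : FreeMonoid Γ →* M)
    (L : Set (Word Γ)) : Prop :=
  L = {α | ∃ s e : M, IsLinkedPair s e ∧ (pairLang h s e ∩ L).Nonempty ∧ α ∈ pairLang h s e}

/-- `L ⊆ Γ^∞` is (`ω`-)regular: it is recognized by a homomorphism to a finite monoid. -/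
def IsOmegaRegular {Γ : Type u} (L : Set (Word Γ)) : Prop :=
  ∃ (M : Type) (_ : Monoid M) (_ : Finite M) (h : FreeMonoid Γ →* M), Recognizes h L

/-! ### The syntactic monoid of a language `L ⊆ Γ^∞` -/

/-- The relation `u ≈_L v`. -/
def SyntRel {Γ : Type u} (L : Set (Word Γ)) (p q : FreeMonoid Γ) : Prop :=
  ∀ x y z : FreeMonoid Γ,
    ((x * p * y) • omegaWord z ∈ L ↔ (x * q * y) • omegaWord z ∈ L) ∧
      (x • omegaWord (p * y) ∈ L ↔ x • omegaWord (q * y) ∈ L)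

theorem eq_cycle {Γ : Type u} {l : List Γ} (h : l ≠ []) {s t : Stream' Γ}
    (hs : s = l ++ₛ s) (ht : t = l ++ₛ t) : s = t := by
  have key : ∀ n : ℕ, s.get n = t.get n := by
    intro n
    induction n using Nat.strong_induction_on with
    | _ n ih =>
      have hl : 0 < l.length := List.length_pos_iff.mpr h
      rcases lt_or_ge n l.length with hn | hn
      · rw [hs, ht, Stream'.get_append_left _ _ _ hn, Stream'.get_append_left _ _ _ hn]
      · obtain ⟨k, rfl⟩ := Nat.exists_eq_add_of_le hn
        rw [hs, ht, Stream'.get_append_right, Stream'.get_append_right]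
        exact ih k (by omega)
  exact Stream'.ext key

theorem omegaWord_rotate {Γ : Type u} (p q : FreeMonoid Γ) :
    omegaWord (p * q) = p • omegaWord (q * p) := by
  by_cases h : (p * q).toList = []
  · have h' := h
    rw [FreeMonoid.toList_mul, List.append_eq_nil_iff] at h'
    have hp : p = 1 := h'.1
    have hq : q = 1 := h'.2
    subst hp; subst hq
    rw [one_smul]
  · have h2 : (q * p).toList ≠ [] := by
      rw [FreeMonoid.toList_mul] at h ⊢
      intro h3
      rw [List.append_eq_nil_iff] at h3
      exact h (by rw [h3.1, h3.2]; rfl)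
    unfold omegaWord
    rw [dif_neg h, dif_neg h2]
    refine congrArg Word.inf (eq_cycle h (Stream'.cycle_eq _ h) ?_)
    conv_lhs => rw [Stream'.cycle_eq _ h2]
    simp only [FreeMonoid.toList_mul, Stream'.append_append_stream]

theorem SyntRel.mul {Γ : Type u} {L : Set (Word Γ)} {p q p' q' : FreeMonoid Γ}
    (h : SyntRel L p q) (h' : SyntRel L p' q') : SyntRel L (p * p') (q * q') := by
  intro x y z
  constructor
  · have h1 := (h x (p' * y) z).1
    have h2 := (h' (x * q) y z).1
    simp only [← mul_assoc] at h1 h2 ⊢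
    exact h1.trans h2
  · have h1 := (h x (p' * y) 1).2
    have h2 := (h' (x * q) (y * q) 1).2
    rw [← mul_assoc, ← mul_assoc] at h1
    rw [mul_smul, mul_smul, ← mul_assoc, ← mul_assoc, ← omegaWord_rotate, ← omegaWord_rotate,
      ← mul_assoc, ← mul_assoc] at h2
    exact h1.trans h2

/-- The syntactic congruence `≈_L` on `Γ^*`. -/
def syntCon {Γ : Type u} (L : Set (Word Γ)) : Con (FreeMonoid Γ) where
  r := SyntRel L
  iseqv :=
    ⟨fun _ _ _ _ => ⟨Iff.rfl, Iff.rfl⟩,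
      fun h x y z => ⟨(h x y z).1.symm, (h x y z).2.symm⟩,
      fun h h' x y z => ⟨(h x y z).1.trans (h' x y z).1, (h x y z).2.trans (h' x y z).2⟩⟩
  mul' := SyntRel.mul

/-- The syntactic monoid `Synt(L) = Γ^* / ≈_L`. -/
abbrev Synt {Γ : Type u} (L : Set (Word Γ)) : Type u := (syntCon L).Quotient

/-- The syntactic homomorphism `Γ^* → Synt(L)`. -/
def syntHom {Γ : Type u} (L : Set (Word Γ)) : FreeMonoid Γ →* Synt L := (syntCon L).mk'

/-! ### First-order logic over words, the fragment `𝔹Σ₂` -/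

/-- The relation symbols: the binary symbol `<` and a unary symbol `λ(·) = a` for each letter. -/
inductive WordRel (Γ : Type u) : ℕ → Type u
  | letter (a : Γ) : WordRel Γ 1
  | lt : WordRel Γ 2

/-- The first-order language of words over `Γ`. -/
def wordLang (Γ : Type u) : FirstOrder.Language.{0, u} := ⟨fun _ => Empty, WordRel Γ⟩

/-- A word as a first-order structure; its universe is the set of its positions. -/
instance wordStructure {Γ : Type u} (α : Word Γ) : (wordLang Γ).Structure α.Pos where
  funMap := fun f _ => Empty.elim f
  RelMap := fun r => match r with
    | WordRel.letter a => fun x => α.get? (x 0).1 = some a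
    | WordRel.lt => fun x => (x 0).1 < (x 1).1

/-- Formulas in prenex normal form `∃ x₁ ⋯ ∃ xₖ ∀ y₁ ⋯ ∀ yₘ ψ` with `ψ` quantifier-free. -/
inductive IsSigma2 {Γ : Type u} : ∀ {n : ℕ}, (wordLang Γ).BoundedFormula Empty n → Prop
  | of_isUniversal {n : ℕ} {φ : (wordLang Γ).BoundedFormula Empty n} (h : φ.IsUniversal) :
      IsSigma2 φ
  | ex {n : ℕ} {φ : (wordLang Γ).BoundedFormula Empty (n + 1)} (h : IsSigma2 φ) : IsSigma2 φ.ex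

/-- Boolean combinations of `Σ₂`-sentences. -/
inductive IsBSigma2 {Γ : Type u} : (wordLang Γ).Sentence → Prop
  | of_isSigma2 {φ : (wordLang Γ).Sentence} (h : IsSigma2 φ) : IsBSigma2 φ
  | not {φ : (wordLang Γ).Sentence} (h : IsBSigma2 φ) : IsBSigma2 φ.not
  | and {φ ψ : (wordLang Γ).Sentence} (h : IsBSigma2 φ) (h' : IsBSigma2 ψ) : IsBSigma2 (φ ⊓ ψ)
  | or {φ ψ : (wordLang Γ).Sentence} (h : IsBSigma2 φ) (h' : IsBSigma2 ψ) : IsBSigma2 (φ ⊔ ψ)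

/-- `L ⊆ Γ^∞` is definable in `𝔹Σ₂`. -/
def BSigma2Definable {Γ : Type u} (L : Set (Word Γ)) : Prop :=
  ∃ φ : (wordLang Γ).Sentence, IsBSigma2 φ ∧ L = {α | φ.Realize α.Pos}

/-- A language `K ⊆ Γ^*` of finite words is definable in `𝔹Σ₂` over finite words. -/
def BSigma2DefinableFin {Γ : Type u} (K : Set (FreeMonoid Γ)) : Prop :=
  ∃ φ : (wordLang Γ).Sentence, IsBSigma2 φ ∧ K = {p | φ.Realize (Word.fin p).Pos}

/-! ### Monomials -/

/-- The monomial `A₀^* a₁ A₁^* a₂ ⋯ Aₙ₋₁^* aₙ Aₙ^∞`, given by the list of the pairs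
`(A₀, a₁), …, (Aₙ₋₁, aₙ)` and by `Aₙ`. -/
def monomial {Γ : Type u} : List (Set Γ × Γ) → Set Γ → Set (Word Γ)
  | [], B => inftyOf B
  | (A, a) :: l, B => concat (starOf A) (concat {FreeMonoid.of a} (monomial l B))

/-- The finite Boolean combinations of monomials. -/
def monomialCombinations (Γ : Type u) : BooleanSubalgebra (Set (Word Γ)) :=
  BooleanSubalgebra.closure {L | ∃ (l : List (Set Γ × Γ)) (B : Set Γ), L = monomial l B}

/-! ### The pseudovariety `V₂` -/

/-- The syntactic congruence of a language of finite words. -/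
def finSyntCon {A : Type u} (K : Set (FreeMonoid A)) : Con (FreeMonoid A) where
  r p q := ∀ x y : FreeMonoid A, x * p * y ∈ K ↔ x * q * y ∈ K
  iseqv := ⟨fun _ _ _ => Iff.rfl, fun h x y => (h x y).symm,
    fun h h' x y => (h x y).trans (h' x y)⟩
  mul' := by
    intro p q p' q' h h' x y
    have h1 := h x (p' * y)
    have h2 := h' (x * q) y
    simp only [← mul_assoc] at h1 h2 ⊢
    exact h1.trans h2

/-- The syntactic monoid of a language of finite words. -/
abbrev FinSynt {A : Type u} (K : Set (FreeMonoid A)) : Type u := (finSyntCon K).Quotient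

/-- `M` is a divisor of `N`: a homomorphic image of a submonoid of `N`. -/
def Divides (M : Type v) (N : Type w) [Monoid M] [Monoid N] : Prop :=
  ∃ (S : Submonoid N) (f : S →* M), Function.Surjective f

/-- The pseudovariety `V₂` that corresponds to `𝔹Σ₂` over finite words: the pseudovariety of finite
monoids generated by the syntactic monoids of the `𝔹Σ₂`-definable languages of finite words over
finite alphabets, that is, the divisors of finite direct products of such monoids. -/
def InV2 (M : Type v) [Monoid M] : Prop :=
  Finite M ∧
    ∃ (ι : Type) (_ : Finite ι) (A : ι → Type) (_ : ∀ i, Finite (A i))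
      (K : ∀ i, Set (FreeMonoid (A i))),
      (∀ i, BSigma2DefinableFin (K i)) ∧ Divides M (∀ i, FinSynt (K i))

end OmegaWords

open OmegaWords

/-! For each `n` the preorder `MonLE n` puts `α` below `β` when every monomial of degree at most `n`
(at most `n` marked letters) that contains `α` also contains `β`. Over a finite alphabet there are
finitely many such monomials, so the Boolean combinations of monomials are exactly the languages
saturated for the equivalence of some `MonLE n` (`exists_monSaturated`,
`MonSaturated.mem_monomialCombinations`). The other two conditions are compared with this one.

Logic. A monomial guesses its marked positions and constrains every other position, which is a
`Σ₂`-sentence. Conversely, the models of a `Σ₂`-sentence are upward closed for some `MonLE N`: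
existential witnesses in `α` are carried to `β` by cutting at the corresponding letters
(`MonLE.exists_split_letter`), and a refutation of the universal part, which consists of boundedly
many positions of `β`, is pulled back to `α` (`exists_reflects`).

From saturation to algebra. `MonLE n` is compatible with concatenation, so it yields a finite
quotient `monHom Γ n`, through which the syntactic homomorphism of a saturated language factors.
This quotient is controlled by the syntactic monoids of the monomials, whence membership in `V₂`.
For the linked pairs, `s x = t` and `t y = s` with `x`, `y` in the image of `C^*` allow the
construction of one ultimately periodic word for each pair such that both words lie in the same
monomials of degree at most `n`.

From algebra to saturation. Membership in `V₂` makes the syntactic homomorphism factor through some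
`monHom Γ k`. By Ramsey's theorem each word has a stable factorization `u E γ` (`IsStable`). If `α`
and `β` are equivalent for a much larger degree, their stable factorizations have the same tail
alphabet `C`, and their prefixes `u`, `v` agree in `monHom Γ k` up to right factors in `C^*`
(`IsStable.exists_monHom_eq`). This is the hypothesis of condition (b) for the two linked pairs.
Regularity enters because each `[s][e]^ω` of a linked pair of `Synt L` is contained in `L` or
disjoint from it (`IsOmegaRegular.mem_iff_of_mem_pairLang`). -/

namespace OmegaWords

universe u v w

/-! ### Positions, factorizations and cancellation in words -/

namespace Word

variable {Γ : Type u}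

theorem smul_fin (p w : FreeMonoid Γ) : p • fin w = fin (p * w) := rfl

theorem smul_inf (p : FreeMonoid Γ) (s : Stream' Γ) : p • inf s = inf (p.toList ++ₛ s) := rfl

theorem get?_fin (w : FreeMonoid Γ) (i : ℕ) : (fin w).get? i = w.toList[i]? := rfl

theorem get?_inf (s : Stream' Γ) (i : ℕ) : (inf s).get? i = some (s.get i) := rfl

theorem get?_smul_left (p : FreeMonoid Γ) (α : Word Γ) {i : ℕ} (h : i < p.length) :
    (p • α).get? i = p.toList[i]? := by
  rcases α with w | s
  · rw [smul_fin, get?_fin, FreeMonoid.toList_mul]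
    exact List.getElem?_append_left h
  · rw [smul_inf, get?_inf, Stream'.get_append_left _ _ _ h]
    exact (List.getElem?_eq_getElem h).symm

theorem get?_smul_right (p : FreeMonoid Γ) (α : Word Γ) (i : ℕ) :
    (p • α).get? (p.length + i) = α.get? i := by
  rcases α with w | s
  · rw [smul_fin, get?_fin, FreeMonoid.toList_mul, get?_fin]
    refine (List.getElem?_append_right (Nat.le_add_right _ _)).trans ?_
    congr 1
    exact Nat.add_sub_cancel_left _ _
  · rw [smul_inf, get?_inf, get?_inf]
    congr 1
    exact Stream'.get_append_right _ _ _

theorem get?_smul_right' (p : FreeMonoid Γ) (α : Word Γ) {i : ℕ} (h : p.length ≤ i) :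
    (p • α).get? i = α.get? (i - p.length) := by
  obtain ⟨j, rfl⟩ := Nat.exists_eq_add_of_le h
  rw [get?_smul_right, Nat.add_sub_cancel_left]

theorem ext_get? {α β : Word Γ} (h : ∀ i, α.get? i = β.get? i) : α = β := by
  rcases α with w | s <;> rcases β with w' | s'
  · exact congrArg fin (List.ext_getElem? h)
  · have := h w.toList.length
    rw [get?_fin, get?_inf, List.getElem?_eq_none (le_refl _)] at this
    cases this
  · have := h w'.toList.length
    rw [get?_fin, get?_inf, List.getElem?_eq_none (le_refl _)] at this
    cases this
  · refine congrArg inf (Stream'.ext fun n => ?_)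
    exact Option.some.inj (h n)

theorem smul_cancel {p : FreeMonoid Γ} {α β : Word Γ} (h : p • α = p • β) : α = β :=
  ext_get? fun i => by rw [← get?_smul_right p α, h, get?_smul_right]

theorem get?_isSome_of_lt {α : Word Γ} {i j : ℕ} (hij : i ≤ j) (h : (α.get? j).isSome) :
    (α.get? i).isSome := by
  rcases α with w | s
  · rw [get?_fin] at *
    rw [isSome_getElem?] at *
    exact lt_of_le_of_lt hij h
  · rfl

/-- Every word splits at each of its positions. -/
theorem exists_split {α : Word Γ} {i : ℕ} {a : Γ} (h : α.get? i = some a) :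
    ∃ (p : FreeMonoid Γ) (γ : Word Γ), p.length = i ∧ α = p • FreeMonoid.of a • γ := by
  rcases α with w | s
  · rw [get?_fin] at h
    obtain ⟨hi, rfl⟩ := List.getElem?_eq_some_iff.1 h
    refine ⟨FreeMonoid.ofList (w.toList.take i), fin (FreeMonoid.ofList (w.toList.drop (i + 1))),
      ?_, ?_⟩
    · change (w.toList.take i).length = i
      rw [List.length_take]
      omega
    · rw [smul_fin, smul_fin]
      refine congrArg fin ?_
      change w.toList = w.toList.take i ++ ([w.toList[i]] ++ w.toList.drop (i + 1))
      simp
  · have h' : s.get i = a := Option.some.inj h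
    subst h'
    refine ⟨FreeMonoid.ofList (s.take i), inf (s.drop (i + 1)), ?_, ?_⟩
    · exact Stream'.length_take _ _
    · rw [smul_inf, smul_inf]
      refine congrArg inf ?_
      change s = s.take i ++ₛ ([s.get i] ++ₛ s.drop (i + 1))
      conv_lhs => rw [← Stream'.append_take_drop i s]
      congr 1
      rw [Stream'.cons_append_stream, Stream'.nil_append_stream]
      conv_lhs => rw [← Stream'.eta (s.drop i)]
      rw [Stream'.head_drop, Stream'.tail_drop]
      rfl

/-- Levi's lemma for two left factors of one word: both are read off the same letters, so the
shorter is a prefix of the longer. -/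
theorem prefix_of_le {p q : FreeMonoid Γ} {α β : Word Γ} (h : p • α = q • β)
    (hl : p.length ≤ q.length) : ∃ w, q = p * w ∧ α = w • β := by
  have hq : q = p * FreeMonoid.ofList (q.toList.drop p.length) := by
    change q.toList = p.toList ++ q.toList.drop p.length
    have : p.toList = q.toList.take p.length := by
      refine List.ext_getElem? fun i => ?_
      rw [List.getElem?_take]
      split_ifs with hi
      · rw [← get?_smul_left p α hi, h, get?_smul_left q β (lt_of_lt_of_le hi hl)]
      · exact List.getElem?_eq_none (not_lt.1 hi)
    conv_rhs => rw [this]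
    exact (List.take_append_drop _ _).symm
  refine ⟨_, hq, ?_⟩
  rw [hq, mul_smul] at h
  exact smul_cancel h

theorem eq_of_length_eq {p q : FreeMonoid Γ} {α β : Word Γ} (h : p • α = q • β)
    (hl : p.length = q.length) : p = q ∧ α = β := by
  obtain ⟨w, hw, hα⟩ := prefix_of_le h hl.le
  have : w = 1 := by
    rw [hw, FreeMonoid.length_mul] at hl
    exact FreeMonoid.length_eq_zero.1 (by omega)
  subst this
  rw [mul_one] at hw
  rw [one_smul] at hα
  exact ⟨hw.symm, hα⟩

theorem of_smul_inj {a b : Γ} {α β : Word Γ} (h : FreeMonoid.of a • α = FreeMonoid.of b • β) :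
    a = b ∧ α = β := by
  obtain ⟨h1, h2⟩ := eq_of_length_eq h rfl
  exact ⟨FreeMonoid.of_injective h1, h2⟩

theorem get?_of_smul_zero (a : Γ) (α : Word Γ) : (FreeMonoid.of a • α).get? 0 = some a :=
  get?_smul_left _ _ Nat.zero_lt_one

theorem get?_split (p : FreeMonoid Γ) (a : Γ) (α : Word Γ) :
    (p • FreeMonoid.of a • α).get? p.length = some a := by
  have := get?_smul_right p (FreeMonoid.of a • α) 0
  rwa [Nat.add_zero, get?_of_smul_zero] at this

theorem get?_split_right (p : FreeMonoid Γ) (a : Γ) (α : Word Γ) (i : ℕ) :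
    (p • FreeMonoid.of a • α).get? (p.length + 1 + i) = α.get? i := by
  rw [add_assoc, get?_smul_right]
  exact get?_smul_right (FreeMonoid.of a) α i

theorem exists_cons {α : Word Γ} (h : α ≠ fin 1) :
    ∃ (a : Γ) (γ : Word Γ), α = FreeMonoid.of a • γ := by
  rcases h0 : α.get? 0 with _ | a
  · refine absurd (ext_get? fun i => ?_) h
    have : α.get? i = none := by
      by_contra hi
      have := get?_isSome_of_lt (Nat.zero_le i) (Option.isSome_iff_ne_none.2 hi)
      rw [h0] at this
      cases this
    rw [this]
    rfl
  · obtain ⟨p, γ, hp, hα⟩ := exists_split h0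
    rw [FreeMonoid.length_eq_zero.1 hp, one_smul] at hα
    exact ⟨a, γ, hα⟩

theorem get?_left_iff (p : FreeMonoid Γ) (α : Word Γ) {i : ℕ} (h : i < p.length) :
    (p • α).get? i = (fin p).get? i := get?_smul_left p α h

theorem lt_length {p : FreeMonoid Γ} {i : ℕ} {a : Γ} (h : (fin p).get? i = some a) :
    i < p.length := by
  rw [get?_fin] at h
  exact (List.getElem?_eq_some_iff.1 h).1

end Word

variable {Γ : Type u}

/-! ### Alphabets, `A^*` and `A^∞` -/

theorem alph_one : alph (1 : FreeMonoid Γ) = ∅ := by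
  ext a
  exact ⟨fun h => absurd h FreeMonoid.notMem_one, fun h => h.elim⟩

theorem alph_mul (p q : FreeMonoid Γ) : alph (p * q) = alph p ∪ alph q := by
  ext a
  exact FreeMonoid.mem_mul

theorem alph_of (a : Γ) : alph (FreeMonoid.of a) = {a} := by
  ext b
  exact FreeMonoid.mem_of

theorem one_mem_starOf (A : Set Γ) : (1 : FreeMonoid Γ) ∈ starOf A := by
  simp [starOf, alph_one]

theorem mul_mem_starOf {A : Set Γ} {p q : FreeMonoid Γ} :
    p * q ∈ starOf A ↔ p ∈ starOf A ∧ q ∈ starOf A := by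
  simp [starOf, alph_mul]

theorem of_mem_starOf {A : Set Γ} {a : Γ} : FreeMonoid.of a ∈ starOf A ↔ a ∈ A := by
  simp [starOf, alph_of]

theorem mem_alph_iff {p : FreeMonoid Γ} {a : Γ} : a ∈ alph p ↔ ∃ i, (Word.fin p).get? i = some a :=
  List.mem_iff_getElem?

theorem fin_mem_inftyOf {A : Set Γ} {p : FreeMonoid Γ} : Word.fin p ∈ inftyOf A ↔ p ∈ starOf A := by
  constructor
  · intro h a ha
    obtain ⟨i, hi⟩ := mem_alph_iff.1 ha
    exact h i a hi
  · intro h i a hi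
    exact h (mem_alph_iff.2 ⟨i, hi⟩)

theorem smul_mem_inftyOf {A : Set Γ} {p : FreeMonoid Γ} {α : Word Γ} :
    p • α ∈ inftyOf A ↔ p ∈ starOf A ∧ α ∈ inftyOf A := by
  constructor
  · intro h
    refine ⟨fin_mem_inftyOf.1 fun i a hi => h i a ?_, fun i a hi => h (p.length + i) a ?_⟩
    · rwa [Word.get?_left_iff _ _ (Word.lt_length hi)]
    · rwa [Word.get?_smul_right]
  · rintro ⟨h1, h2⟩ i a hi
    rcases lt_or_ge i p.length with h | h
    · rw [Word.get?_left_iff _ _ h] at hi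
      exact fin_mem_inftyOf.2 h1 i a hi
    · rw [Word.get?_smul_right' _ _ h] at hi
      exact h2 _ a hi

theorem inftyOf_mono {A B : Set Γ} (h : A ⊆ B) : inftyOf A ⊆ inftyOf B :=
  fun _ hα i a hi => h (hα i a hi)

theorem starOf_mono {A B : Set Γ} (h : A ⊆ B) : starOf A ⊆ starOf B :=
  fun _ hp => hp.trans h

/-! ### Gluing and splitting monomials -/

theorem mem_monomial_cons {A B : Set Γ} {a : Γ} {l : List (Set Γ × Γ)} {α : Word Γ} :
    α ∈ monomial ((A, a) :: l) B ↔
      ∃ p ∈ starOf A, ∃ γ ∈ monomial l B, α = p • FreeMonoid.of a • γ := by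
  constructor
  · rintro ⟨p, hp, _, ⟨_, rfl, γ, hγ, rfl⟩, rfl⟩
    exact ⟨p, hp, γ, hγ, rfl⟩
  · rintro ⟨p, hp, γ, hγ, rfl⟩
    exact ⟨p, hp, _, ⟨_, rfl, γ, hγ, rfl⟩, rfl⟩

/-- The first alphabet of a monomial. -/
def firstSet : List (Set Γ × Γ) → Set Γ → Set Γ
  | [], B => B
  | (A, _) :: _, _ => A

theorem firstSet_append (l r : List (Set Γ × Γ)) (B : Set Γ) :
    firstSet (l ++ r) B = firstSet l (firstSet r B) := by
  cases l <;> rfl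

theorem monomial_prepend {l : List (Set Γ × Γ)} {B : Set Γ} {p : FreeMonoid Γ} {α : Word Γ}
    (hp : p ∈ starOf (firstSet l B)) (hα : α ∈ monomial l B) : p • α ∈ monomial l B := by
  rcases l with _ | ⟨⟨A, a⟩, l⟩
  · exact smul_mem_inftyOf.2 ⟨hp, hα⟩
  · obtain ⟨q, hq, γ, hγ, rfl⟩ := mem_monomial_cons.1 hα
    exact mem_monomial_cons.2 ⟨p * q, mul_mem_starOf.2 ⟨hp, hq⟩, γ, hγ, (mul_smul _ _ _).symm⟩

/-- Converse of `monomial_split`. The left part must end in the first alphabet of the right part,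
because a cut inside an alphabet leaves that alphabet on both sides. -/
theorem monomial_append {l r : List (Set Γ × Γ)} {B : Set Γ} {p : FreeMonoid Γ} {α : Word Γ}
    (hp : Word.fin p ∈ monomial l (firstSet r B)) (hα : α ∈ monomial r B) :
    p • α ∈ monomial (l ++ r) B := by
  induction l generalizing p with
  | nil => exact monomial_prepend (fin_mem_inftyOf.1 hp) hα
  | cons x l ih =>
    obtain ⟨A, a⟩ := x
    obtain ⟨q, hq, γ, hγ, h⟩ := mem_monomial_cons.1 hp
    rcases γ with w | s
    · have h' : p = q * (FreeMonoid.of a * w) := Word.fin.inj h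
      subst h'
      refine mem_monomial_cons.2 ⟨q, hq, w • α, ih hγ, ?_⟩
      rw [mul_smul, mul_smul]
    · cases h

/-- A factorization of a word in a monomial splits the monomial. -/
theorem monomial_split {l : List (Set Γ × Γ)} {B : Set Γ} {p : FreeMonoid Γ} {α : Word Γ}
    (h : p • α ∈ monomial l B) : ∃ l₁ r, l = l₁ ++ r ∧
      Word.fin p ∈ monomial l₁ (firstSet r B) ∧ α ∈ monomial r B := by
  induction l generalizing p with
  | nil =>
    obtain ⟨h1, h2⟩ := smul_mem_inftyOf.1 h
    exact ⟨[], [], rfl, fin_mem_inftyOf.2 h1, h2⟩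
  | cons x l ih =>
    obtain ⟨A, a⟩ := x
    obtain ⟨q, hq, γ, hγ, hpq⟩ := mem_monomial_cons.1 h
    rcases le_or_gt p.length q.length with hl | hl
    · obtain ⟨w, rfl, rfl⟩ := Word.prefix_of_le hpq hl
      rw [mul_mem_starOf] at hq
      exact ⟨[], _, rfl, fin_mem_inftyOf.2 hq.1, mem_monomial_cons.2 ⟨w, hq.2, γ, hγ, rfl⟩⟩
    · rw [← mul_smul] at hpq
      obtain ⟨w, rfl, rfl⟩ := Word.prefix_of_le hpq.symm (by
        rw [FreeMonoid.length_mul, FreeMonoid.length_of]; omega)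
      obtain ⟨l₁, r, rfl, h1, h2⟩ := ih hγ
      refine ⟨(A, a) :: l₁, r, rfl, mem_monomial_cons.2 ⟨q, hq, _, h1, ?_⟩, h2⟩
      rw [Word.smul_fin, Word.smul_fin, mul_assoc]

theorem monomial_extend {l : List (Set Γ × Γ)} {B : Set Γ} {p : FreeMonoid Γ} {α : Word Γ}
    (hp : Word.fin p ∈ monomial l B) (hα : α ∈ inftyOf B) : p • α ∈ monomial l B := by
  have := monomial_append (r := []) (B := B) hp hα
  rwa [List.append_nil] at this

theorem monomial_extend_fin {l : List (Set Γ × Γ)} {B : Set Γ} {p q : FreeMonoid Γ}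
    (hp : Word.fin p ∈ monomial l B) (hq : q ∈ starOf B) : Word.fin (p * q) ∈ monomial l B :=
  monomial_extend hp (fin_mem_inftyOf.2 hq)

/-! ### The preorders given by the monomials of bounded degree -/

/-- Every monomial of degree at most `n` that contains `α` contains `β`. -/
def MonLE (n : ℕ) (α β : Word Γ) : Prop :=
  ∀ (l : List (Set Γ × Γ)) (B : Set Γ), l.length ≤ n → α ∈ monomial l B → β ∈ monomial l B

theorem MonLE.refl (n : ℕ) (α : Word Γ) : MonLE n α α := fun _ _ _ h => h

theorem MonLE.trans {n : ℕ} {α β γ : Word Γ} (h : MonLE n α β) (h' : MonLE n β γ) : MonLE n α γ :=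
  fun l B hl hα => h' l B hl (h l B hl hα)

theorem MonLE.mono {m n : ℕ} (hmn : m ≤ n) {α β : Word Γ} (h : MonLE n α β) : MonLE m α β :=
  fun l B hl hα => h l B (hl.trans hmn) hα

/-- A monomial containing `p • α` splits at the cut into two monomials whose degrees add up to the
original one, so each half can be transferred separately without loss of degree. -/
theorem MonLE.smul {n : ℕ} {p q : FreeMonoid Γ} {α β : Word Γ}
    (h : MonLE n (Word.fin p) (Word.fin q)) (h' : MonLE n α β) : MonLE n (p • α) (q • β) := by
  intro l B hl hα
  obtain ⟨l₁, r, rfl, h1, h2⟩ := monomial_split hα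
  rw [List.length_append] at hl
  exact monomial_append (h _ _ (by omega) h1) (h' _ _ (by omega) h2)

theorem MonLE.mul {n : ℕ} {p q p' q' : FreeMonoid Γ} (h : MonLE n (Word.fin p) (Word.fin q))
    (h' : MonLE n (Word.fin p') (Word.fin q')) :
    MonLE n (Word.fin (p * p')) (Word.fin (q * q')) := h.smul h'

theorem MonLE.mem_inftyOf {n : ℕ} {α β : Word Γ} (h : MonLE n α β) {A : Set Γ}
    (hα : α ∈ inftyOf A) : β ∈ inftyOf A := h [] A (Nat.zero_le n) hα

theorem MonLE.alph_subset {n : ℕ} {p q : FreeMonoid Γ} (h : MonLE n (Word.fin p) (Word.fin q)) :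
    alph q ⊆ alph p :=
  fin_mem_inftyOf.1 (h.mem_inftyOf (fin_mem_inftyOf.2 (le_refl (alph p))))

/-- Two monomials that share a word contain a common monomial around that word. -/
theorem exists_monomial_inter {n : ℕ} {l₁ l₂ : List (Set Γ × Γ)} {B₁ B₂ : Set Γ} {α : Word Γ}
    (h₁ : α ∈ monomial l₁ B₁) (h₂ : α ∈ monomial l₂ B₂) (h : l₁.length + l₂.length ≤ n) :
    ∃ (l : List (Set Γ × Γ)) (B : Set Γ), l.length ≤ n ∧ α ∈ monomial l B ∧
      monomial l B ⊆ monomial l₁ B₁ ∧ monomial l B ⊆ monomial l₂ B₂ := by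
  induction n generalizing l₁ l₂ B₁ B₂ α with
  | zero =>
    obtain rfl : l₁ = [] := List.length_eq_zero_iff.1 (by omega)
    obtain rfl : l₂ = [] := List.length_eq_zero_iff.1 (by omega)
    exact ⟨[], B₁ ∩ B₂, le_refl _, fun i a hi => ⟨h₁ i a hi, h₂ i a hi⟩,
      inftyOf_mono Set.inter_subset_left, inftyOf_mono Set.inter_subset_right⟩
  | succ n ih =>
    -- the first marked letter of one monomial is read inside the first alphabet of the other one
    have step : ∀ {l₁ l₂ : List (Set Γ × Γ)} {B₁ B₂ A : Set Γ} {a : Γ} {p : FreeMonoid Γ}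
        {γ : Word Γ}, p ∈ starOf A → p ∈ starOf (firstSet l₂ B₂) → a ∈ firstSet l₂ B₂ →
        γ ∈ monomial l₁ B₁ → γ ∈ monomial l₂ B₂ → l₁.length + l₂.length ≤ n →
        ∃ (l : List (Set Γ × Γ)) (B : Set Γ), l.length ≤ n + 1 ∧
          p • FreeMonoid.of a • γ ∈ monomial l B ∧
          monomial l B ⊆ monomial ((A, a) :: l₁) B₁ ∧ monomial l B ⊆ monomial l₂ B₂ := by
      intro l₁ l₂ B₁ B₂ A a p γ hp hp' ha h3 h4 h5
      obtain ⟨l, B, hl, hγ, hs, hs'⟩ := ih h3 h4 h5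
      refine ⟨(A ∩ firstSet l₂ B₂, a) :: l, B, Nat.succ_le_succ hl,
        mem_monomial_cons.2 ⟨p, fun x hx => ⟨hp hx, hp' hx⟩, γ, hγ, rfl⟩, ?_, ?_⟩
      · intro β hβ
        obtain ⟨q, hq, δ, hδ, rfl⟩ := mem_monomial_cons.1 hβ
        exact mem_monomial_cons.2 ⟨q, starOf_mono Set.inter_subset_left hq, δ, hs hδ, rfl⟩
      · intro β hβ
        obtain ⟨q, hq, δ, hδ, rfl⟩ := mem_monomial_cons.1 hβ
        exact monomial_prepend (starOf_mono Set.inter_subset_right hq)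
          (monomial_prepend (of_mem_starOf.2 ha) (hs' hδ))
    -- The case in which the first mark of one monomial comes strictly before every mark of the
    -- other: that mark lies inside the first alphabet of the other monomial, so `step` applies.
    have finish : ∀ {l₁ l₂ : List (Set Γ × Γ)} {B₁ B₂ A₁ : Set Γ} {a₁ : Γ} {p₁ : FreeMonoid Γ}
        {γ₁ : Word Γ}, p₁ ∈ starOf A₁ → γ₁ ∈ monomial l₁ B₁ → l₁.length + l₂.length ≤ n →
        p₁ • FreeMonoid.of a₁ • γ₁ ∈ monomial l₂ B₂ →
        (∀ A₂ a₂ l, l₂ = (A₂, a₂) :: l → ∃ p₂ ∈ starOf A₂, ∃ γ₂ ∈ monomial l B₂,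
          p₁ • FreeMonoid.of a₁ • γ₁ = p₂ • FreeMonoid.of a₂ • γ₂ ∧ p₁.length < p₂.length) →
        ∃ (l : List (Set Γ × Γ)) (B : Set Γ), l.length ≤ n + 1 ∧
          p₁ • FreeMonoid.of a₁ • γ₁ ∈ monomial l B ∧
          monomial l B ⊆ monomial ((A₁, a₁) :: l₁) B₁ ∧ monomial l B ⊆ monomial l₂ B₂ := by
      intro l₁ l₂ B₁ B₂ A₁ a₁ p₁ γ₁ hp₁ hγ₁ hn h₂ hlt
      rcases l₂ with _ | ⟨⟨A₂, a₂⟩, l₂⟩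
      · obtain ⟨h3, h4⟩ := smul_mem_inftyOf.1 h₂
        obtain ⟨h4, h5⟩ := smul_mem_inftyOf.1 h4
        exact step hp₁ h3 (of_mem_starOf.1 h4) hγ₁ h5 hn
      · obtain ⟨p₂, hp₂, γ₂, hγ₂, h12, hl⟩ := hlt _ _ _ rfl
        rw [← mul_smul] at h12
        obtain ⟨w, rfl, rfl⟩ := Word.prefix_of_le h12 (by
          rw [FreeMonoid.length_mul, FreeMonoid.length_of]; omega)
        rw [mul_mem_starOf, mul_mem_starOf, of_mem_starOf] at hp₂
        exact step hp₁ hp₂.1.1 hp₂.1.2 hγ₁ (mem_monomial_cons.2 ⟨w, hp₂.2, γ₂, hγ₂, rfl⟩) hn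
    rcases l₁ with _ | ⟨⟨A₁, a₁⟩, l₁⟩
    · rcases l₂ with _ | ⟨⟨A₂, a₂⟩, l₂⟩
      · obtain ⟨l, B, h3, h4⟩ := ih h₁ h₂ (Nat.zero_le n)
        exact ⟨l, B, h3.trans (Nat.le_succ n), h4⟩
      · obtain ⟨p, hp, γ, hγ, rfl⟩ := mem_monomial_cons.1 h₂
        obtain ⟨l, B, h3, h4, h5, h6⟩ := finish (l₂ := []) (B₂ := B₁) hp hγ
          (by simp at h ⊢; omega) h₁ (by simp)
        exact ⟨l, B, h3, h4, h6, h5⟩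
    · obtain ⟨p₁, hp₁, γ₁, hγ₁, rfl⟩ := mem_monomial_cons.1 h₁
      simp only [List.length_cons] at h
      rcases l₂ with _ | ⟨⟨A₂, a₂⟩, l₂⟩
      · exact finish (l₂ := []) hp₁ hγ₁ (by simp at h ⊢; omega) h₂ (by simp)
      · obtain ⟨p₂, hp₂, γ₂, hγ₂, h12⟩ := mem_monomial_cons.1 h₂
        simp only [List.length_cons] at h
        rcases lt_trichotomy p₁.length p₂.length with hl | hl | hl
        · refine finish hp₁ hγ₁ (by simp only [List.length_cons]; omega) h₂ ?_
          rintro _ _ _ ⟨rfl, rfl⟩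
          exact ⟨p₂, hp₂, γ₂, hγ₂, h12, hl⟩
        · obtain ⟨rfl, h13⟩ := Word.eq_of_length_eq h12 hl
          obtain ⟨rfl, rfl⟩ := Word.of_smul_inj h13
          obtain ⟨l, B, h6, h7, h8, h9⟩ := ih hγ₁ hγ₂ (by omega)
          refine ⟨(A₁ ∩ A₂, a₁) :: l, B, by simp only [List.length_cons]; omega,
            mem_monomial_cons.2 ⟨p₁, fun x hx => ⟨hp₁ hx, hp₂ hx⟩, γ₁, h7, rfl⟩, ?_, ?_⟩
          · intro β hβ
            obtain ⟨q, hq, δ, hδ, rfl⟩ := mem_monomial_cons.1 hβ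
            exact mem_monomial_cons.2 ⟨q, starOf_mono Set.inter_subset_left hq, δ, h8 hδ, rfl⟩
          · intro β hβ
            obtain ⟨q, hq, δ, hδ, rfl⟩ := mem_monomial_cons.1 hβ
            exact mem_monomial_cons.2 ⟨q, starOf_mono Set.inter_subset_right hq, δ, h9 hδ, rfl⟩
        · rw [h12] at h₁ ⊢
          obtain ⟨l, B, h3, h4, h5, h6⟩ := finish (a₁ := a₂) hp₂ hγ₂
            (by simp only [List.length_cons]; omega) h₁ (by
              rintro _ _ _ ⟨rfl, rfl⟩
              exact ⟨p₁, hp₁, γ₁, hγ₁, h12.symm, hl⟩)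
          exact ⟨l, B, h3, h4, h6, h5⟩

/-- The monomials of degree at most `n`. -/
def degLE (Γ : Type u) (n : ℕ) : Set (List (Set Γ × Γ) × Set Γ) := {x | x.1.length ≤ n}

theorem finite_degLE (Γ : Type u) [Finite Γ] (n : ℕ) : (degLE Γ n).Finite := by
  have h : (degLE Γ n) = {l | l.length ≤ n} ×ˢ Set.univ := by
    ext x
    simp [degLE]
  rw [h]
  exact (List.finite_length_le _ _).prod Set.finite_univ

/-- Around each word there is a monomial of bounded degree whose words are all above it. -/
theorem exists_monomial_monLE (Γ : Type u) [Finite Γ] (n : ℕ) : ∃ N : ℕ, ∀ α : Word Γ,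
    ∃ (l : List (Set Γ × Γ)) (B : Set Γ), l.length ≤ N ∧ α ∈ monomial l B ∧
      ∀ β ∈ monomial l B, MonLE n α β := by
  classical
  have key : ∀ T : Finset (List (Set Γ × Γ) × Set Γ), ∀ α : Word Γ,
      (∀ x ∈ T, α ∈ monomial x.1 x.2) → ∃ (l : List (Set Γ × Γ)) (B : Set Γ),
        l.length ≤ ∑ x ∈ T, x.1.length ∧ α ∈ monomial l B ∧
        ∀ x ∈ T, monomial l B ⊆ monomial x.1 x.2 := by
    intro T α
    induction T using Finset.induction_on with
    | empty =>
      intro _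
      exact ⟨[], Set.univ, Nat.zero_le _, fun _ _ _ => Set.mem_univ _, by simp⟩
    | insert x T hx ih =>
      intro h
      obtain ⟨l, B, h1, h2, h3⟩ := ih fun y hy => h y (Finset.mem_insert_of_mem hy)
      obtain ⟨l', B', h4, h5, h6, h7⟩ :=
        exists_monomial_inter (h x (Finset.mem_insert_self _ _)) h2 le_rfl
      refine ⟨l', B', ?_, h5, ?_⟩
      · rw [Finset.sum_insert hx]
        omega
      · intro y hy
        rcases Finset.mem_insert.1 hy with rfl | hy
        · exact h6
        · exact h7.trans (h3 y hy)
  -- Only the monomials that contain `α` are intersected, but the degree bound sums over all of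
  -- them, so it does not depend on `α`.
  refine ⟨∑ x ∈ (finite_degLE Γ n).toFinset, x.1.length, fun α => ?_⟩
  obtain ⟨l, B, h1, h2, h3⟩ := key ((finite_degLE Γ n).toFinset.filter
    fun x => α ∈ monomial x.1 x.2) α fun x hx => (Finset.mem_filter.1 hx).2
  refine ⟨l, B, h1.trans (Finset.sum_le_sum_of_subset (Finset.filter_subset _ _)), h2, ?_⟩
  intro β hβ l' B' hl' hα
  exact h3 (l', B') (Finset.mem_filter.2 ⟨(finite_degLE Γ n).mem_toFinset.2 hl', hα⟩) hβ

theorem mem_monomial_append_cons {l r : List (Set Γ × Γ)} {A B : Set Γ} {a : Γ} {α : Word Γ}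
    (h : α ∈ monomial (l ++ (A, a) :: r) B) :
    ∃ p γ, α = p • FreeMonoid.of a • γ ∧ Word.fin p ∈ monomial l A ∧ γ ∈ monomial r B := by
  induction l generalizing α with
  | nil =>
    obtain ⟨p, hp, γ, hγ, rfl⟩ := mem_monomial_cons.1 h
    exact ⟨p, γ, rfl, fin_mem_inftyOf.2 hp, hγ⟩
  | cons x l ih =>
    obtain ⟨A', a'⟩ := x
    obtain ⟨p, hp, γ, hγ, rfl⟩ := mem_monomial_cons.1 h
    obtain ⟨q, δ, rfl, h1, h2⟩ := ih hγ
    refine ⟨p * (FreeMonoid.of a' * q), δ, ?_, ?_, h2⟩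
    · rw [mul_smul, mul_smul]
    · exact mem_monomial_cons.2 ⟨p, hp, _, h1, rfl⟩

/-- Take the monomials of `exists_monomial_monLE` around `p` and around `γ` and join them by the
marked letter `a`. The result has degree at most `N + (N + 1)`, and reading it in `β` finds an `a`
with the required factors on both sides. -/
theorem MonLE.exists_split_letter (Γ : Type u) [Finite Γ] (n : ℕ) :
    ∃ N : ℕ, ∀ (p : FreeMonoid Γ) (a : Γ) (γ β : Word Γ), MonLE N (p • FreeMonoid.of a • γ) β →
      ∃ q δ, β = q • FreeMonoid.of a • δ ∧ MonLE n (Word.fin p) (Word.fin q) ∧ MonLE n γ δ := by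
  obtain ⟨N, hN⟩ := exists_monomial_monLE Γ n
  refine ⟨N + (N + 1), fun p a γ β h => ?_⟩
  obtain ⟨l, A, h1, h2, h3⟩ := hN (Word.fin p)
  obtain ⟨r, B, h4, h5, h6⟩ := hN γ
  obtain ⟨q, δ, rfl, h7, h8⟩ := mem_monomial_append_cons (h (l ++ (A, a) :: r) B
    (by simp only [List.length_append, List.length_cons]; omega)
    (monomial_append (r := (A, a) :: r) h2
      (mem_monomial_cons.2 ⟨1, one_mem_starOf A, γ, h5, (one_smul _ _).symm⟩)))
  exact ⟨q, δ, rfl, h3 _ h7, h6 _ h8⟩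

/-- A nonempty tail supplies the letter that marks the cut. -/
theorem MonLE.exists_split (Γ : Type u) [Finite Γ] (n : ℕ) :
    ∃ N : ℕ, ∀ (p : FreeMonoid Γ) (γ β : Word Γ), γ ≠ Word.fin 1 → MonLE N (p • γ) β →
      ∃ q δ, β = q • δ ∧ MonLE n (Word.fin p) (Word.fin q) ∧ MonLE n γ δ := by
  obtain ⟨N, hN⟩ := MonLE.exists_split_letter Γ n
  refine ⟨N, fun p γ β hγ h => ?_⟩
  obtain ⟨a, γ, rfl⟩ := Word.exists_cons hγ
  obtain ⟨q, δ, rfl, h1, h2⟩ := hN _ _ _ _ h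
  exact ⟨q, _, rfl, h1, (MonLE.refl n (Word.fin (FreeMonoid.of a))).smul h2⟩

/-! ### Saturated languages -/

/-- `L` is a union of classes for the equivalence given by the monomials of degree at most `n`. -/
def MonSaturated (n : ℕ) (L : Set (Word Γ)) : Prop :=
  ∀ α β : Word Γ, MonLE n α β → MonLE n β α → α ∈ L → β ∈ L

theorem MonSaturated.mono {m n : ℕ} (hmn : m ≤ n) {L : Set (Word Γ)} (h : MonSaturated m L) :
    MonSaturated n L :=
  fun α β h1 h2 => h α β (h1.mono hmn) (h2.mono hmn)

theorem MonSaturated.compl {n : ℕ} {L : Set (Word Γ)} (h : MonSaturated n L) :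
    MonSaturated n Lᶜ :=
  fun α β h1 h2 hα hβ => hα (h β α h2 h1 hβ)

theorem MonSaturated.union {n : ℕ} {L L' : Set (Word Γ)} (h : MonSaturated n L)
    (h' : MonSaturated n L') : MonSaturated n (L ∪ L') :=
  fun α β h1 h2 hα => hα.imp (h α β h1 h2) (h' α β h1 h2)

theorem MonSaturated.inter {n : ℕ} {L L' : Set (Word Γ)} (h : MonSaturated n L)
    (h' : MonSaturated n L') : MonSaturated n (L ∩ L') :=
  fun α β h1 h2 hα => ⟨h α β h1 h2 hα.1, h' α β h1 h2 hα.2⟩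

theorem exists_monSaturated {L : Set (Word Γ)} (h : L ∈ monomialCombinations Γ) :
    ∃ n, MonSaturated n L := by
  refine BooleanSubalgebra.closure_bot_sup_induction (p := fun L _ => ∃ n, MonSaturated n L)
    ?_ ?_ ?_ ?_ h
  · rintro _ ⟨l, B, rfl⟩
    exact ⟨l.length, fun α β h1 _ => h1 l B le_rfl⟩
  · exact ⟨0, fun _ _ _ _ h => h⟩
  · rintro K - K' - ⟨n, hn⟩ ⟨n', hn'⟩
    exact ⟨max n n', (hn.mono (le_max_left _ _)).union (hn'.mono (le_max_right _ _))⟩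
  · rintro K - ⟨n, hn⟩
    exact ⟨n, hn.compl⟩

/-- A set determined by membership in finitely many elements of a Boolean algebra of sets belongs to
it. The induction removes one of the finitely many monomials at a time, treating the inside and the
outside of it separately. -/
theorem MonSaturated.mem_monomialCombinations [Finite Γ] {n : ℕ} {L : Set (Word Γ)}
    (h : MonSaturated n L) : L ∈ monomialCombinations Γ := by
  classical
  have key : ∀ T : Finset (List (Set Γ × Γ) × Set Γ), ∀ L : Set (Word Γ),
      (∀ α β : Word Γ, (∀ x ∈ T, α ∈ monomial x.1 x.2 ↔ β ∈ monomial x.1 x.2) → α ∈ L → β ∈ L) →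
      L ∈ monomialCombinations Γ := by
    intro T
    induction T using Finset.induction_on with
    | empty =>
      intro L hL
      rcases L.eq_empty_or_nonempty with rfl | ⟨α, hα⟩
      · exact BooleanSubalgebra.bot_mem
      · have : L = ⊤ := Set.eq_univ_of_forall fun β => hL α β (by simp) hα
        rw [this]
        exact BooleanSubalgebra.top_mem
    | insert x T hx ih =>
      intro L hL
      have hx' : monomial x.1 x.2 ∈ monomialCombinations Γ :=
        BooleanSubalgebra.subset_closure ⟨x.1, x.2, rfl⟩
      set P := monomial x.1 x.2 with hP
      -- the unions of classes for `T` that agree with `L` inside and outside of `P`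
      have h1 : ∀ Q : Set (Word Γ), (Q = P ∨ Q = Pᶜ) →
          {β | ∃ α ∈ L ∩ Q, ∀ y ∈ T, α ∈ monomial y.1 y.2 ↔ β ∈ monomial y.1 y.2} ∈
            monomialCombinations Γ := by
        intro Q _
        apply ih
        rintro β γ hβγ ⟨α, hα, hαβ⟩
        exact ⟨α, hα, fun y hy => (hαβ y hy).trans (hβγ y hy)⟩
      have h2 := BooleanSubalgebra.sup_mem
        (BooleanSubalgebra.inf_mem (h1 P (Or.inl rfl)) hx')
        (BooleanSubalgebra.inf_mem (h1 Pᶜ (Or.inr rfl)) (BooleanSubalgebra.compl_mem hx'))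
      convert h2
      ext β
      constructor
      · intro hβ
        by_cases hβP : β ∈ P
        · exact Or.inl ⟨⟨β, ⟨hβ, hβP⟩, fun _ _ => Iff.rfl⟩, hβP⟩
        · exact Or.inr ⟨⟨β, ⟨hβ, hβP⟩, fun _ _ => Iff.rfl⟩, hβP⟩
      · rintro (⟨⟨α, ⟨hα, hαP⟩, hαβ⟩, hβP⟩ | ⟨⟨α, ⟨hα, hαP⟩, hαβ⟩, hβP⟩) <;>
        · refine hL α β (fun y hy => ?_) hα
          rcases Finset.mem_insert.1 hy with rfl | hy
          · first
              | exact iff_of_true hαP hβP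
              | exact iff_of_false hαP hβP
          · exact hαβ y hy
  refine key (finite_degLE Γ n).toFinset L fun α β hαβ => h α β ?_ ?_
  · exact fun l B hl => (hαβ (l, B) ((finite_degLE Γ n).mem_toFinset.2 hl)).1
  · exact fun l B hl => (hαβ (l, B) ((finite_degLE Γ n).mem_toFinset.2 hl)).2

/-! ### Inverse images under homomorphisms -/

theorem fin_one_mem_monomial {l : List (Set Γ × Γ)} {B : Set Γ} :
    Word.fin 1 ∈ monomial l B ↔ l = [] := by
  constructor
  · intro h
    rcases l with _ | ⟨⟨A, a⟩, l⟩
    · rfl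
    · obtain ⟨p, -, γ, -, h⟩ := mem_monomial_cons.1 h
      have := Word.get?_split p a γ
      rw [← h] at this
      exact absurd (Word.lt_length this) (Nat.not_lt_zero _)
  · rintro rfl
    exact fin_mem_inftyOf.2 (one_mem_starOf B)

/-- The preimage of a monomial need not be one monomial, but around each of its words it contains
one of no larger degree: letters of `p` whose image crosses a mark become marks, the others are
absorbed by an alphabet. The clause on `firstSet` is what the induction needs to prepend an absorbed
letter. -/
theorem exists_monomial_comap {Δ : Type v} (φ : FreeMonoid Γ →* FreeMonoid Δ) (p : FreeMonoid Γ)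
    {l : List (Set Δ × Δ)} {B : Set Δ} (h : Word.fin (φ p) ∈ monomial l B) :
    ∃ (l' : List (Set Γ × Γ)) (B' : Set Γ), l'.length ≤ l.length ∧ Word.fin p ∈ monomial l' B' ∧
      firstSet l' B' = {c | φ (FreeMonoid.of c) ∈ starOf (firstSet l B)} ∧
      ∀ q, Word.fin q ∈ monomial l' B' → Word.fin (φ q) ∈ monomial l B := by
  have hstar : ∀ (A : Set Δ) (q : FreeMonoid Γ),
      q ∈ starOf {c | φ (FreeMonoid.of c) ∈ starOf A} → φ q ∈ starOf A := by
    intro A q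
    induction q using FreeMonoid.inductionOn' with
    | one => exact fun _ => by rw [map_one]; exact one_mem_starOf A
    | of_mul a q ih =>
      rw [mul_mem_starOf, of_mem_starOf, map_mul, mul_mem_starOf]
      exact fun h => ⟨h.1, ih h.2⟩
  induction p using FreeMonoid.inductionOn' generalizing l with
  | one =>
    rw [map_one, fin_one_mem_monomial] at h
    subst h
    refine ⟨[], {c | φ (FreeMonoid.of c) ∈ starOf B}, le_rfl, fin_one_mem_monomial.2 rfl, rfl, ?_⟩
    intro q hq
    exact fin_mem_inftyOf.2 (hstar B q (fin_mem_inftyOf.1 hq))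
  | of_mul b p ih =>
    rw [map_mul, ← Word.smul_fin] at h
    obtain ⟨l₁, r, rfl, h1, h2⟩ := monomial_split h
    obtain ⟨r', B', h3, h4, h5, h6⟩ := ih h2
    rcases l₁ with _ | ⟨x, l₁⟩
    · refine ⟨r', B', h3, ?_, h5, h6⟩
      rw [← Word.smul_fin]
      refine monomial_prepend ?_ h4
      rw [h5, of_mem_starOf]
      exact fin_mem_inftyOf.1 h1
    -- The image of `b` uses up at least the mark of `x`, which pays for the new mark `b`. The
    -- alphabet `x.1` is the first one of the whole monomial.
    · refine ⟨({c | φ (FreeMonoid.of c) ∈ starOf x.1}, b) :: r', B', ?_, ?_, rfl, ?_⟩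
      · simp only [List.length_cons, List.length_append]
        omega
      · exact mem_monomial_cons.2 ⟨1, one_mem_starOf _, _, h4, (one_smul _ _).symm⟩
      · intro q hq
        obtain ⟨p', hp', γ, hγ, hq⟩ := mem_monomial_cons.1 hq
        rcases γ with w | s
        · obtain rfl : q = p' * (FreeMonoid.of b * w) := Word.fin.inj hq
          rw [map_mul, map_mul, ← Word.smul_fin, ← Word.smul_fin]
          exact monomial_prepend (hstar x.1 p' hp') (monomial_append h1 (h6 w hγ))
        · cases hq

theorem MonLE.map {Δ : Type v} (φ : FreeMonoid Γ →* FreeMonoid Δ) {n : ℕ} {p q : FreeMonoid Γ}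
    (h : MonLE n (Word.fin p) (Word.fin q)) : MonLE n (Word.fin (φ p)) (Word.fin (φ q)) := by
  intro l B hl hp
  obtain ⟨l', B', h1, h2, -, h3⟩ := exists_monomial_comap φ p hp
  exact h3 q (h l' B' (h1.trans hl) h2)

/-! ### The finite quotient of bounded degree -/

/-- The congruence on finite words given by the monomials of degree at most `n`. -/
def monCon (Γ : Type u) (n : ℕ) : Con (FreeMonoid Γ) where
  r p q := MonLE n (Word.fin p) (Word.fin q) ∧ MonLE n (Word.fin q) (Word.fin p)
  iseqv := ⟨fun _ => ⟨.refl _ _, .refl _ _⟩, fun h => ⟨h.2, h.1⟩,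
    fun h h' => ⟨h.1.trans h'.1, h'.2.trans h.2⟩⟩
  mul' h h' := ⟨h.1.mul h'.1, h.2.mul h'.2⟩

/-- The canonical homomorphism to the quotient by the monomials of degree at most `n`. -/
def monHom (Γ : Type u) (n : ℕ) : FreeMonoid Γ →* (monCon Γ n).Quotient := (monCon Γ n).mk'

theorem monHom_eq_iff {n : ℕ} {p q : FreeMonoid Γ} : monHom Γ n p = monHom Γ n q ↔
    MonLE n (Word.fin p) (Word.fin q) ∧ MonLE n (Word.fin q) (Word.fin p) :=
  Con.eq (monCon Γ n)

/-- A class is determined by the finite set of monomials of degree at most `n` containing its words.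
-/
instance [Finite Γ] (n : ℕ) : Finite (monCon Γ n).Quotient := by
  have : Finite (degLE Γ n) := (finite_degLE Γ n)
  let f : (monCon Γ n).Quotient → Set (degLE Γ n) := fun x =>
    {y | ∃ p, monHom Γ n p = x ∧ Word.fin p ∈ monomial y.1.1 y.1.2}
  refine Finite.of_injective f fun x y hxy => ?_
  obtain ⟨p, rfl⟩ := Con.mk'_surjective x
  obtain ⟨q, rfl⟩ := Con.mk'_surjective y
  have aux : ∀ p q : FreeMonoid Γ, f (monHom Γ n p) = f (monHom Γ n q) →
      MonLE n (Word.fin p) (Word.fin q) := by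
    intro p q h l B hl hp
    have h1 : (⟨(l, B), hl⟩ : degLE Γ n) ∈ f (monHom Γ n q) := h ▸ ⟨p, rfl, hp⟩
    obtain ⟨q', h2, h3⟩ := h1
    exact (monHom_eq_iff.1 h2).1 l B hl h3
  exact monHom_eq_iff.2 ⟨aux p q hxy, aux q p hxy.symm⟩

/-! ### Transfer of positions between comparable words -/

/-- The set of all `y` with `n + 1 + y ∈ Y`. -/
noncomputable def shiftDown (n : ℕ) (Y : Finset ℕ) : Finset ℕ :=
  Y.preimage (fun y => n + 1 + y) fun _ _ _ _ h => Nat.add_left_cancel h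

theorem mem_shiftDown {n : ℕ} {Y : Finset ℕ} {y : ℕ} : y ∈ shiftDown n Y ↔ n + 1 + y ∈ Y :=
  Finset.mem_preimage

theorem card_shiftDown_le (n : ℕ) (Y : Finset ℕ) : (shiftDown n Y).card ≤ Y.card :=
  Finset.card_le_card_of_injOn (fun y => n + 1 + y) (fun _ hy => mem_shiftDown.1 hy)
    fun _ _ _ _ h => Nat.add_left_cancel h

theorem card_shiftDown_lt {n y : ℕ} {Y : Finset ℕ} (hy : y ∈ Y) (hn : y ≤ n) :
    (shiftDown n Y).card < Y.card := by
  have h : (shiftDown n Y).card ≤ (Y.erase y).card :=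
    Finset.card_le_card_of_injOn (fun z => n + 1 + z)
      (fun z hz => Finset.mem_erase.2 ⟨by dsimp only; omega, mem_shiftDown.1 hz⟩)
      fun _ _ _ _ h => Nat.add_left_cancel h
  exact lt_of_le_of_lt h (Finset.card_erase_lt_of_mem hy)

theorem exists_first_occurrence {α : Word Γ} {a : Γ} (h : α ∉ inftyOf {a}ᶜ) :
    ∃ p ∈ starOf ({a}ᶜ : Set Γ), ∃ γ, α = p • FreeMonoid.of a • γ := by
  classical
  have h' : ∃ i, α.get? i = some a := by
    by_contra hne
    push Not at hne
    exact h fun i b hb hba => hne i (by rw [hb, Set.mem_singleton_iff.1 hba])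
  obtain ⟨p, γ, hp, hα⟩ := Word.exists_split (Nat.find_spec h')
  refine ⟨p, fun b hb hba => ?_, γ, hα⟩
  obtain ⟨i, hi⟩ := mem_alph_iff.1 hb
  have hlt := Word.lt_length hi
  refine Nat.find_min h' (hp ▸ hlt) ?_
  rw [hα, Word.get?_left_iff _ _ hlt, hi, Set.mem_singleton_iff.1 hba]

theorem first_occurrence_unique {p q : FreeMonoid Γ} {a : Γ} {γ δ : Word Γ}
    (hp : p ∈ starOf ({a}ᶜ : Set Γ)) (hq : q ∈ starOf ({a}ᶜ : Set Γ))
    (h : p • FreeMonoid.of a • γ = q • FreeMonoid.of a • δ) : p = q ∧ γ = δ := by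
  have aux : ∀ {p q : FreeMonoid Γ} {γ δ : Word Γ}, q ∈ starOf ({a}ᶜ : Set Γ) →
      p • FreeMonoid.of a • γ = q • FreeMonoid.of a • δ → ¬ p.length < q.length := by
    intro p q γ δ hq h hlt
    rw [← mul_smul] at h
    obtain ⟨w, rfl, -⟩ := Word.prefix_of_le h (by
      rw [FreeMonoid.length_mul, FreeMonoid.length_of]; omega)
    rw [mul_mem_starOf, mul_mem_starOf, of_mem_starOf] at hq
    exact hq.1.2 rfl
  obtain ⟨rfl, h'⟩ := Word.eq_of_length_eq h
    (le_antisymm (not_lt.1 (aux hp h.symm)) (not_lt.1 (aux hq h)))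
  exact ⟨rfl, (Word.of_smul_inj h').2⟩

/-- If `α` lies below `β`, then the short scattered subwords of `β` occur in `α`. -/
theorem MonLE.exists_embedding {m : ℕ} {α β : Word Γ} (h : MonLE m α β) (Y : Finset ℕ)
    (hY : Y.card ≤ m) (hpos : ∀ y ∈ Y, (β.get? y).isSome) :
    ∃ f : ℕ → ℕ, StrictMonoOn f Y ∧ ∀ y ∈ Y, α.get? (f y) = β.get? y := by
  induction m generalizing α β Y with
  | zero =>
    obtain rfl : Y = ∅ := Finset.card_eq_zero.1 (by omega)
    exact ⟨id, by simp [StrictMonoOn], by simp⟩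
  | succ m ih =>
    rcases Y.eq_empty_or_nonempty with rfl | hne
    · exact ⟨id, by simp [StrictMonoOn], by simp⟩
    set y₀ := Y.min' hne with hy₀
    have hy₀Y : y₀ ∈ Y := Y.min'_mem hne
    have hmin : ∀ y ∈ Y, y₀ ≤ y := fun y hy => Y.min'_le y hy
    obtain ⟨a, ha⟩ := Option.isSome_iff_exists.1 (hpos y₀ hy₀Y)
    have hβ : β ∉ inftyOf ({a}ᶜ : Set Γ) := fun hβ => hβ y₀ a ha rfl
    have hα : α ∉ inftyOf ({a}ᶜ : Set Γ) := fun hα => hβ (h.mem_inftyOf hα)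
    obtain ⟨p, hp, γ, rfl⟩ := exists_first_occurrence hα
    obtain ⟨q, hq, δ, rfl⟩ := exists_first_occurrence hβ
    -- Prefixing a monomial with `({a}ᶜ, a)` forces the cut at the first `a`, which is unique; this
    -- costs one degree.
    have hγδ : MonLE m γ δ := by
      intro l B hl hγ
      obtain ⟨q', hq', δ', hδ', h'⟩ := mem_monomial_cons.1
        (h (({a}ᶜ, a) :: l) B (Nat.succ_le_succ hl) (mem_monomial_cons.2 ⟨p, hp, γ, hγ, rfl⟩))
      rwa [(first_occurrence_unique hq hq' h').2]
    -- The position `y₀` need not be the first `a` of `β`, but it is not before it; hence all later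
    -- elements of `Y` lie in `δ`, while `y₀` itself may be sent to the first `a` of `α`.
    have hqy : q.length ≤ y₀ := by
      by_contra hlt
      rw [Word.get?_left_iff _ _ (not_le.1 hlt)] at ha
      exact hq (mem_alph_iff.2 ⟨_, ha⟩) rfl
    have hmem : ∀ y ∈ Y, y ≠ y₀ → q.length + 1 + (y - (q.length + 1)) = y := by
      intro y hy hne
      have := hmin y hy
      omega
    set Y' := shiftDown q.length (Y.erase y₀) with hY'
    obtain ⟨f, hf1, hf2⟩ := ih hγδ Y' (by
        have h1 : Y'.card ≤ _ := card_shiftDown_le q.length (Y.erase y₀)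
        have h2 := Finset.card_erase_lt_of_mem hy₀Y
        omega) (by
      intro y hy
      have := hpos _ (Finset.mem_of_mem_erase (mem_shiftDown.1 hy))
      rwa [Word.get?_split_right] at this)
    have hmem' : ∀ y ∈ Y, y ≠ y₀ → y - (q.length + 1) ∈ Y' := by
      intro y hy hne
      rw [hY', mem_shiftDown, hmem y hy hne]
      exact Finset.mem_erase.2 ⟨hne, hy⟩
    refine ⟨fun y => if y = y₀ then p.length else p.length + 1 + f (y - (q.length + 1)), ?_, ?_⟩
    · intro y hy z hz hyz
      have h1 := hmin y hy
      have hz₀ : z ≠ y₀ := by omega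
      simp only [hz₀, if_false]
      split_ifs with hy'
      · omega
      · have h2 := hf1 (hmem' y hy hy') (hmem' z hz hz₀) (by
          have := hmem y hy hy'
          have := hmem z hz hz₀
          omega)
        omega
    · intro y hy
      dsimp only
      split_ifs with hy'
      · subst hy'
        rw [ha, Word.get?_split]
      · rw [Word.get?_split_right, hf2 _ (hmem' y hy hy')]
        conv_rhs => rw [← hmem y hy hy', Word.get?_split_right]

/-- Sets of at most `m` positions of `β`, together with the positions `g x` for `x ∈ X`, map to
`α` in a way that is monotone, compatible with the labels and inverse to `g` on `X`. -/
def Reflects (m : ℕ) (X : Finset ℕ) (g : ℕ → ℕ) (α β : Word Γ) : Prop :=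
  ∀ Y : Finset ℕ, Y.card ≤ m → (∀ y ∈ Y, (β.get? y).isSome) →
    ∃ f : ℕ → ℕ, StrictMonoOn f (Y ∪ X.image g : Finset ℕ) ∧
      (∀ y ∈ Y ∪ X.image g, α.get? (f y) = β.get? y) ∧ ∀ x ∈ X, f (g x) = x

/-- Induction on the number of positions in `X`: cut `α` at the smallest one and `β` at a matching
letter. Positions of `β` before the cut go back by `MonLE.exists_embedding`, those after it by
induction. The map `g` is fixed before `Y` is given, as the alternation `∃∀` demands. -/
theorem exists_reflects (Γ : Type u) [Finite Γ] (m q : ℕ) : ∃ N : ℕ, ∀ α β : Word Γ, MonLE N α β →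
    ∀ X : Finset ℕ, X.card ≤ q → (∀ x ∈ X, (α.get? x).isSome) → ∃ g, Reflects m X g α β := by
  have empty : ∀ α β : Word Γ, MonLE m α β → ∃ g, Reflects m ∅ g α β := by
    refine fun α β h => ⟨id, fun Y hY hpos => ?_⟩
    obtain ⟨f, h1, h2⟩ := h.exists_embedding Y hY hpos
    exact ⟨f, by simpa using h1, by simpa using h2, by simp⟩
  induction q with
  | zero =>
    refine ⟨m, fun α β h X hX _ => ?_⟩
    obtain rfl : X = ∅ := Finset.card_eq_zero.1 (by omega)
    exact empty α β h
  | succ q ih =>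
    obtain ⟨N, hN⟩ := ih
    -- The left parts must be comparable in degree `m` for the embedding, the right parts in degree
    -- `N` for the induction.
    obtain ⟨N', hN'⟩ := MonLE.exists_split_letter Γ (max m N)
    refine ⟨max m N', fun α β h X hX hpos => ?_⟩
    rcases X.eq_empty_or_nonempty with rfl | hne
    · exact empty α β (h.mono (le_max_left _ _))
    set x₀ := X.min' hne with hx₀
    have hx₀X : x₀ ∈ X := X.min'_mem hne
    have hmin : ∀ x ∈ X, x₀ ≤ x := fun x hx => X.min'_le x hx
    obtain ⟨a, ha⟩ := Option.isSome_iff_exists.1 (hpos x₀ hx₀X)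
    obtain ⟨p, γ, hp, rfl⟩ := Word.exists_split ha
    obtain ⟨p', δ, rfl, h1, h2⟩ := hN' p a γ β (h.mono (le_max_right _ _))
    obtain ⟨g', hg'⟩ := hN γ δ (h2.mono (le_max_right _ _)) (shiftDown x₀ X)
      (by have := card_shiftDown_lt hx₀X le_rfl; omega) (by
        intro x hx
        have := hpos _ (mem_shiftDown.1 hx)
        rwa [← hp, Word.get?_split_right] at this)
    set n₀ := p'.length with hn₀
    -- On `X` the condition `x ≤ x₀` means `x = x₀`, which goes to the letter marking the cut in
    -- `β`.
    let g : ℕ → ℕ := fun x => if x ≤ x₀ then n₀ else n₀ + 1 + g' (x - (x₀ + 1))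
    have hg_ge : ∀ x, n₀ ≤ g x := by
      intro x
      dsimp only [g]
      split_ifs <;> omega
    have hXmem : ∀ x ∈ X, ¬ x ≤ x₀ → x - (x₀ + 1) ∈ shiftDown x₀ X := by
      intro x hx hlt
      rw [mem_shiftDown]
      convert hx using 1
      omega
    refine ⟨g, fun Y hY hYpos => ?_⟩
    obtain ⟨f₁, hf1, hf2⟩ := (h1.mono (le_max_left m N)).exists_embedding (Y.filter (· < n₀))
      ((Finset.card_filter_le _ _).trans hY) (by
        intro y hy
        obtain ⟨hy1, hy2⟩ := Finset.mem_filter.1 hy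
        have := hYpos y hy1
        rwa [Word.get?_left_iff _ _ hy2] at this)
    obtain ⟨f₂, hf3, hf4, hf5⟩ := hg' (shiftDown n₀ Y) ((card_shiftDown_le _ _).trans hY) (by
      intro y hy
      have := hYpos _ (mem_shiftDown.1 hy)
      rwa [Word.get?_split_right] at this)
    have hlow : ∀ y ∈ Y ∪ X.image g, y < n₀ → y ∈ Y.filter (· < n₀) := by
      intro y hy hlt
      rcases Finset.mem_union.1 hy with hy | hy
      · exact Finset.mem_filter.2 ⟨hy, hlt⟩
      · obtain ⟨x, -, rfl⟩ := Finset.mem_image.1 hy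
        exact absurd (hg_ge x) (not_le.2 hlt)
    have hhigh : ∀ y ∈ Y ∪ X.image g, n₀ < y →
        y - (n₀ + 1) ∈ shiftDown n₀ Y ∪ (shiftDown x₀ X).image g' := by
      intro y hy hlt
      rcases Finset.mem_union.1 hy with hy | hy
      · refine Finset.mem_union_left _ (mem_shiftDown.2 ?_)
        convert hy using 1
        omega
      · obtain ⟨x, hx, rfl⟩ := Finset.mem_image.1 hy
        refine Finset.mem_union_right _ (Finset.mem_image.2 ?_)
        have hx' : ¬ x ≤ x₀ := by
          intro hle
          simp only [g, hle, if_true] at hlt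
          omega
        refine ⟨x - (x₀ + 1), hXmem x hx hx', ?_⟩
        simp only [g, hx', if_false]
        omega
    have hf1lt : ∀ y ∈ Y.filter (· < n₀), f₁ y < x₀ := by
      intro y hy
      have h3 := hYpos y (Finset.mem_filter.1 hy).1
      rw [Word.get?_left_iff _ _ (Finset.mem_filter.1 hy).2, ← hf2 y hy] at h3
      obtain ⟨b, hb⟩ := Option.isSome_iff_exists.1 h3
      exact hp ▸ Word.lt_length hb
    refine ⟨fun y => if y < n₀ then f₁ y else if y = n₀ then x₀ else
      x₀ + 1 + f₂ (y - (n₀ + 1)), ?_, ?_, ?_⟩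
    · intro y hy z hz hyz
      rw [Finset.mem_coe] at hy hz
      dsimp only
      rcases lt_trichotomy y n₀ with hy' | hy' | hy'
      · have h3 := hf1lt y (hlow y hy hy')
        rw [if_pos hy']
        split_ifs with hz' hz''
        · exact hf1 (hlow y hy hy') (hlow z hz hz') hyz
        · exact h3
        · omega
      · rw [if_neg (by omega), if_pos hy', if_neg (by omega), if_neg (by omega)]
        omega
      · rw [if_neg (by omega), if_neg (by omega), if_neg (by omega), if_neg (by omega)]
        have := hf3 (hhigh y hy hy') (hhigh z hz (by omega)) (by omega)
        omega
    · intro y hy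
      dsimp only
      split_ifs with hy' hy''
      · have hy3 := hlow y hy hy'
        rw [Word.get?_left_iff _ _ (hp ▸ hf1lt y hy3), hf2 y hy3, Word.get?_left_iff _ _ hy']
      · rw [hy'', ← hp, Word.get?_split, Word.get?_split]
      · have hy3 : n₀ < y := by omega
        rw [← hp, Word.get?_split_right, hf4 _ (hhigh y hy hy3)]
        obtain ⟨z, rfl⟩ := Nat.exists_eq_add_of_le (show n₀ + 1 ≤ y from hy3)
        rw [Nat.add_sub_cancel_left, Word.get?_split_right]
    · intro x hx
      dsimp only [g]
      by_cases hx' : x ≤ x₀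
      · rw [if_pos hx', if_neg (lt_irrefl _), if_pos rfl]
        exact le_antisymm (hmin x hx) hx'
      · rw [if_neg hx', if_neg (by omega), if_neg (by omega), Nat.add_sub_cancel_left,
          hf5 _ (hXmem x hx hx')]
        omega

/-! ### Upward closure of the models of `Σ₂`-sentences -/

section Logic

open FirstOrder FirstOrder.Language

theorem term_eq_var {n : ℕ} (t : (wordLang Γ).Term (Empty ⊕ Fin n)) :
    ∃ i, t = Term.var (Sum.inr i) := by
  rcases t with (e | i) | ⟨f, _⟩
  · exact e.elim
  · exact ⟨i, rfl⟩
  · exact Empty.elim f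

theorem realize_iff_of_isQF {n : ℕ} {φ : (wordLang Γ).BoundedFormula Empty n} (h : φ.IsQF)
    {α β : Word Γ} {xs : Fin n → α.Pos} {ys : Fin n → β.Pos}
    (hlt : ∀ i j, (xs i).1 < (xs j).1 ↔ (ys i).1 < (ys j).1)
    (hletter : ∀ i, α.get? (xs i).1 = β.get? (ys i).1) :
    φ.Realize default xs ↔ φ.Realize default ys := by
  induction h with
  | falsum => exact Iff.rfl
  | imp _ _ ih ih' => exact imp_congr ih ih'
  | of_isAtomic h =>
    rcases h with ⟨t₁, t₂⟩ | ⟨R, ts⟩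
    · obtain ⟨i, rfl⟩ := term_eq_var t₁
      obtain ⟨j, rfl⟩ := term_eq_var t₂
      have h1 := hlt i j
      have h2 := hlt j i
      constructor
      · intro h
        have h3 : (xs i).1 = (xs j).1 := congrArg Subtype.val h
        exact Subtype.ext (show (ys i).1 = (ys j).1 by omega)
      · intro h
        have h3 : (ys i).1 = (ys j).1 := congrArg Subtype.val h
        exact Subtype.ext (show (xs i).1 = (xs j).1 by omega)
    · choose f hf using fun i => term_eq_var (ts i)
      obtain rfl : ts = fun i => Term.var (Sum.inr (f i)) := funext hf
      cases R with
      | letter a =>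
        change α.get? (xs (f 0)).1 = some a ↔ β.get? (ys (f 0)).1 = some a
        rw [hletter]
      | lt => exact hlt (f 0) (f 1)

theorem snoc_val_eq {n : ℕ} {α β : Word Γ} {xs : Fin n → α.Pos} {ys : Fin n → β.Pos} {x : α.Pos}
    {y : β.Pos} {f : ℕ → ℕ} (h : ∀ i, (xs i).1 = f (ys i).1) (hxy : x.1 = f y.1)
    (i : Fin (n + 1)) : ((Fin.snoc xs x : Fin (n + 1) → α.Pos) i).1 =
      f ((Fin.snoc ys y : Fin (n + 1) → β.Pos) i).1 := by
  refine Fin.lastCases ?_ (fun i => ?_) i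
  · rw [Fin.snoc_last, Fin.snoc_last]
    exact hxy
  · rw [Fin.snoc_castSucc, Fin.snoc_castSucc]
    exact h i

/-- A universal formula is refuted by values for its variables. These form the set `Y`, whose size
depends on the formula only, and a map that preserves order and labels on `Y` carries the refutation
along. -/
theorem exists_refutation {n : ℕ} {φ : (wordLang Γ).BoundedFormula Empty n} (h : φ.IsUniversal) :
    ∃ m : ℕ, ∀ (β : Word Γ) (ys : Fin n → β.Pos), ¬ φ.Realize default ys →
      ∃ Y : Finset ℕ, Y.card ≤ m ∧ (∀ y ∈ Y, (β.get? y).isSome) ∧ (∀ i, (ys i).1 ∈ Y) ∧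
        ∀ (α : Word Γ) (xs : Fin n → α.Pos) (f : ℕ → ℕ), StrictMonoOn f Y →
          (∀ y ∈ Y, α.get? (f y) = β.get? y) → (∀ i, (xs i).1 = f (ys i).1) →
          ¬ φ.Realize default xs := by
  induction h with
  | @of_isQF n φ h =>
    refine ⟨n, fun β ys hφ => ⟨Finset.univ.image fun i => (ys i).1, ?_, ?_, ?_, ?_⟩⟩
    · exact Finset.card_image_le.trans (by simp)
    · intro y hy
      obtain ⟨i, -, rfl⟩ := Finset.mem_image.1 hy
      exact (ys i).2
    · exact fun i => Finset.mem_image_of_mem _ (Finset.mem_univ i)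
    · intro α xs f hf hletter hxs
      have hmem : ∀ i, (ys i).1 ∈ Finset.univ.image fun i => (ys i).1 :=
        fun i => Finset.mem_image_of_mem _ (Finset.mem_univ i)
      rwa [realize_iff_of_isQF h (β := β) (ys := ys)]
      · intro i j
        rw [hxs, hxs]
        exact hf.lt_iff_lt (hmem i) (hmem j)
      · intro i
        rw [hxs]
        exact hletter _ (hmem i)
  | @all n φ h ih =>
    obtain ⟨m, hm⟩ := ih
    refine ⟨m, fun β ys hφ => ?_⟩
    rw [BoundedFormula.realize_all, not_forall] at hφ
    obtain ⟨y, hy⟩ := hφ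
    obtain ⟨Y, h1, h2, h3, h4⟩ := hm β _ hy
    refine ⟨Y, h1, h2, fun i => ?_, fun α xs f hf hletter hxs => ?_⟩
    · have := h3 i.castSucc
      rwa [Fin.snoc_castSucc] at this
    · have hyY := h3 (Fin.last n)
      rw [Fin.snoc_last] at hyY
      have hx : (α.get? (f y.1)).isSome := by
        rw [hletter _ hyY]
        exact y.2
      rw [BoundedFormula.realize_all, not_forall]
      refine ⟨⟨f y.1, hx⟩, h4 α _ f hf hletter (snoc_val_eq hxs rfl)⟩

/-- The set `X` consists of the free variables and the existential witnesses in `α`. Were their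
images under `g` not witnesses in `β`, the refuting positions would be reflected back to `α` by a
map inverse to `g` on `X`. -/
theorem IsSigma2.exists_reflects {n : ℕ} {φ : (wordLang Γ).BoundedFormula Empty n}
    (h : IsSigma2 φ) : ∃ q m : ℕ, ∀ (α : Word Γ) (xs : Fin n → α.Pos), φ.Realize default xs →
      ∃ X : Finset ℕ, X.card ≤ q ∧ (∀ x ∈ X, (α.get? x).isSome) ∧ (∀ i, (xs i).1 ∈ X) ∧
        ∀ (β : Word Γ) (g : ℕ → ℕ) (ys : Fin n → β.Pos), Reflects m X g α β →
          (∀ i, (ys i).1 = g (xs i).1) → φ.Realize default ys := by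
  induction h with
  | @of_isUniversal n φ h =>
    obtain ⟨m, hm⟩ := exists_refutation h
    refine ⟨n, m, fun α xs hφ => ⟨Finset.univ.image fun i => (xs i).1, ?_, ?_, ?_, ?_⟩⟩
    · exact Finset.card_image_le.trans (by simp)
    · intro x hx
      obtain ⟨i, -, rfl⟩ := Finset.mem_image.1 hx
      exact (xs i).2
    · exact fun i => Finset.mem_image_of_mem _ (Finset.mem_univ i)
    · intro β g ys hg hys
      by_contra hne
      obtain ⟨Y, h1, h2, -, h4⟩ := hm β ys hne
      obtain ⟨f, h5, h6, h7⟩ := hg Y h1 h2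
      refine h4 α xs f (h5.mono (Finset.coe_subset.2 Finset.subset_union_left))
        (fun y hy => h6 y (Finset.mem_union_left _ hy)) (fun i => ?_) hφ
      rw [hys, h7 _ (Finset.mem_image_of_mem _ (Finset.mem_univ i))]
  | @ex n φ h ih =>
    obtain ⟨q, m, hm⟩ := ih
    refine ⟨q, m, fun α xs hφ => ?_⟩
    obtain ⟨x, hx⟩ := BoundedFormula.realize_ex.1 hφ
    obtain ⟨X, h1, h2, h3, h4⟩ := hm α _ hx
    refine ⟨X, h1, h2, fun i => ?_, fun β g ys hg hys => ?_⟩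
    · have := h3 i.castSucc
      rwa [Fin.snoc_castSucc] at this
    · have hxX := h3 (Fin.last n)
      rw [Fin.snoc_last] at hxX
      -- Reflecting the empty set already shows that `g` takes values in positions of `β`.
      have hy : (β.get? (g x.1)).isSome := by
        obtain ⟨f, -, h6, h7⟩ := hg ∅ (Nat.zero_le _) (by simp)
        rw [← h6 _ (Finset.mem_union_right _ (Finset.mem_image_of_mem g hxX)), h7 _ hxX]
        exact x.2
      refine BoundedFormula.realize_ex.2 ⟨⟨g x.1, hy⟩, h4 β g _ hg (snoc_val_eq hys rfl)⟩

/-- The models of a `Σ₂`-sentence are upward closed. -/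
theorem IsSigma2.exists_upward_closed [Finite Γ] {φ : (wordLang Γ).Sentence} (h : IsSigma2 φ) :
    ∃ N : ℕ, ∀ α β : Word Γ, MonLE N α β → φ.Realize α.Pos → φ.Realize β.Pos := by
  obtain ⟨q, m, hqm⟩ := h.exists_reflects
  obtain ⟨N, hN⟩ := OmegaWords.exists_reflects Γ m q
  refine ⟨N, fun α β hαβ hα => ?_⟩
  have hα' : BoundedFormula.Realize φ default (default : Fin 0 → α.Pos) := hα
  obtain ⟨X, h1, h2, -, h4⟩ := hqm α default hα'
  obtain ⟨g, hg⟩ := hN α β hαβ X h1 h2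
  exact h4 β g default hg fun i => i.elim0

theorem IsBSigma2.exists_monSaturated [Finite Γ] {φ : (wordLang Γ).Sentence} (h : IsBSigma2 φ) :
    ∃ N : ℕ, MonSaturated N {α : Word Γ | φ.Realize α.Pos} := by
  induction h with
  | of_isSigma2 h =>
    obtain ⟨N, hN⟩ := h.exists_upward_closed
    exact ⟨N, fun α β h1 _ => hN α β h1⟩
  | not _ ih =>
    obtain ⟨N, hN⟩ := ih
    exact ⟨N, hN.compl⟩
  | and _ _ ih ih' =>
    obtain ⟨N, hN⟩ := ih
    obtain ⟨N', hN'⟩ := ih'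
    refine ⟨max N N', ?_⟩
    convert (hN.mono (le_max_left _ _)).inter (hN'.mono (le_max_right _ _)) using 1
    ext α
    exact BoundedFormula.realize_inf
  | or _ _ ih ih' =>
    obtain ⟨N, hN⟩ := ih
    obtain ⟨N', hN'⟩ := ih'
    refine ⟨max N N', ?_⟩
    convert (hN.mono (le_max_left _ _)).union (hN'.mono (le_max_right _ _)) using 1
    ext α
    exact BoundedFormula.realize_sup

theorem BSigma2Definable.exists_monSaturated [Finite Γ] {L : Set (Word Γ)}
    (h : BSigma2Definable L) : ∃ N : ℕ, MonSaturated N L := by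
  obtain ⟨φ, hφ, rfl⟩ := h
  exact hφ.exists_monSaturated

/-! ### Monomials are definable -/

/-- The `∃∀` description of a monomial: the marks are guessed, and each further position is tested
against the alphabet of the gap that contains it. The marks before `y` identify this gap. -/
theorem mem_monomial_iff_exists_positions {l : List (Set Γ × Γ)} {B : Set Γ} {α : Word Γ} :
    α ∈ monomial l B ↔ ∃ x : Fin l.length → ℕ, (∀ i, α.get? (x i) = some (l.get i).2) ∧
      (∀ i j, i < j → x i < x j) ∧ ∀ y b, α.get? y = some b →
        (∀ i, y < x i → (∀ j, j < i → x j < y) → b ∈ (l.get i).1) ∧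
        ((∀ j, x j < y) → b ∈ B) := by
  induction l generalizing α with
  | nil =>
    constructor
    · exact fun h => ⟨Fin.elim0, fun i => i.elim0, fun i => i.elim0,
        fun y b hy => ⟨fun i => i.elim0, fun _ => h y b hy⟩⟩
    · rintro ⟨x, -, -, h⟩ y b hy
      exact (h y b hy).2 fun j => j.elim0
  | cons z l ih =>
    obtain ⟨A, a⟩ := z
    rw [mem_monomial_cons]
    constructor
    · rintro ⟨p, hp, γ, hγ, rfl⟩
      obtain ⟨x, h1, h2, h3⟩ := ih.1 hγ
      refine ⟨Fin.cons p.length fun i => p.length + 1 + x i, ?_, ?_, ?_⟩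
      · refine Fin.cases ?_ fun i => ?_
        · exact Word.get?_split p a γ
        · rw [Fin.cons_succ, Word.get?_split_right]
          exact h1 i
      · refine Fin.cases (Fin.cases (fun h => absurd h (lt_irrefl _)) fun j _ => ?_) fun i =>
          Fin.cases (fun h => absurd h (Fin.not_lt_zero _)) fun j h => ?_
        · rw [Fin.cons_zero, Fin.cons_succ]
          omega
        · rw [Fin.cons_succ, Fin.cons_succ]
          exact Nat.add_lt_add_left (h2 i j (Fin.succ_lt_succ_iff.1 h)) _
      · intro y b hy
        have hsucc : ∀ y', y = p.length + 1 + y' → γ.get? y' = some b := by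
          rintro y' rfl
          rwa [Word.get?_split_right] at hy
        refine ⟨fun i => ?_, fun hj => ?_⟩
        · induction i using Fin.cases with
          | zero =>
          intro hlt _
          rw [Fin.cons_zero] at hlt
          rw [Word.get?_left_iff _ _ hlt] at hy
          exact hp (mem_alph_iff.2 ⟨y, hy⟩)
          | succ i =>
          intro hlt hj
          have h0 := hj 0 (Fin.succ_pos i)
          rw [Fin.cons_zero] at h0
          obtain ⟨y', rfl⟩ := Nat.exists_eq_add_of_le (show p.length + 1 ≤ y from h0)
          rw [Fin.cons_succ] at hlt
          refine (h3 y' b (hsucc y' rfl)).1 i (by omega) fun j hji => ?_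
          have := hj j.succ (Fin.succ_lt_succ_iff.2 hji)
          rw [Fin.cons_succ] at this
          omega
        · have h0 := hj 0
          rw [Fin.cons_zero] at h0
          obtain ⟨y', rfl⟩ := Nat.exists_eq_add_of_le (show p.length + 1 ≤ y from h0)
          refine (h3 y' b (hsucc y' rfl)).2 fun j => ?_
          have := hj j.succ
          rw [Fin.cons_succ] at this
          omega
    · rintro ⟨x, h1, h2, h3⟩
      obtain ⟨p, γ, hp, rfl⟩ := Word.exists_split (h1 0)
      have hx : ∀ i : Fin l.length, x i.succ = p.length + 1 + (x i.succ - (p.length + 1)) := by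
        intro i
        have := h2 0 i.succ (Fin.succ_pos i)
        omega
      refine ⟨p, fun b hb => ?_, γ, ih.2 ⟨fun i => x i.succ - (p.length + 1), ?_, ?_, ?_⟩, rfl⟩
      · obtain ⟨y, hy⟩ := mem_alph_iff.1 hb
        have hlt := Word.lt_length hy
        rw [← Word.get?_left_iff p (FreeMonoid.of a • γ) hlt] at hy
        exact (h3 y b hy).1 0 (hp ▸ hlt) fun j hj => absurd hj (Fin.not_lt_zero _)
      · intro i
        have := h1 i.succ
        rw [hx i] at this
        exact (Word.get?_split_right p a γ _).symm.trans this
      · intro i j hij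
        have h4 := h2 _ _ (Fin.succ_lt_succ_iff.2 hij)
        have h5 := hx i
        have h6 := hx j
        dsimp only
        omega
      · intro y b hy
        have h4 := h3 (p.length + 1 + y) b (by rw [← hy]; exact Word.get?_split_right p a γ y)
        refine ⟨fun i hyi hj => h4.1 i.succ ?_ fun j => ?_,
          fun hj => h4.2 fun j => ?_⟩
        · have := hx i
          dsimp only at hyi
          omega
        · induction j using Fin.cases with
          | zero =>
            intro _
            omega
          | succ j =>
            intro hji
            have h5 := hj j (Fin.succ_lt_succ_iff.1 hji)
            have := hx j
            dsimp only at h5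
            omega
        · induction j using Fin.cases with
          | zero => omega
          | succ j =>
            have h5 := hj j
            have := hx j
            dsimp only at h5
            omega

section Formulas

variable {n : ℕ}

theorem isQF_foldr_inf (l : List ((wordLang Γ).BoundedFormula Empty n)) (h : ∀ φ ∈ l, φ.IsQF) :
    (l.foldr (· ⊓ ·) ⊤).IsQF := by
  induction l with
  | nil => exact BoundedFormula.IsQF.top
  | cons φ l ih =>
    exact (h φ List.mem_cons_self).inf (ih fun ψ hψ => h ψ (List.mem_cons_of_mem _ hψ))

theorem isQF_foldr_sup (l : List ((wordLang Γ).BoundedFormula Empty n)) (h : ∀ φ ∈ l, φ.IsQF) :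
    (l.foldr (· ⊔ ·) ⊥).IsQF := by
  induction l with
  | nil => exact BoundedFormula.isQF_bot
  | cons φ l ih =>
    exact (h φ List.mem_cons_self).sup (ih fun ψ hψ => h ψ (List.mem_cons_of_mem _ hψ))

theorem isQF_iInf {ι : Type*} [Finite ι] {f : ι → (wordLang Γ).BoundedFormula Empty n}
    (h : ∀ i, (f i).IsQF) : (BoundedFormula.iInf f).IsQF := by
  refine isQF_foldr_inf _ fun φ hφ => ?_
  obtain ⟨i, -, rfl⟩ := List.mem_map.1 hφ
  exact h i

theorem isQF_iSup {ι : Type*} [Finite ι] {f : ι → (wordLang Γ).BoundedFormula Empty n}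
    (h : ∀ i, (f i).IsQF) : (BoundedFormula.iSup f).IsQF := by
  refine isQF_foldr_sup _ fun φ hφ => ?_
  obtain ⟨i, -, rfl⟩ := List.mem_map.1 hφ
  exact h i

/-- The formula `xᵢ < xⱼ`. -/
def ltFormula (i j : Fin n) : (wordLang Γ).BoundedFormula Empty n :=
  Relations.boundedFormula (n := 2) (L := wordLang Γ) WordRel.lt
    ![Term.var (Sum.inr i), Term.var (Sum.inr j)]

/-- The formula `λ(xᵢ) = a`. -/
def letterFormula (a : Γ) (i : Fin n) : (wordLang Γ).BoundedFormula Empty n :=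
  Relations.boundedFormula (n := 1) (L := wordLang Γ) (WordRel.letter a)
    ![Term.var (Sum.inr i)]

/-- The formula `λ(xᵢ) ∈ A`. -/
noncomputable def setFormula [Finite Γ] (A : Set Γ) (i : Fin n) :
    (wordLang Γ).BoundedFormula Empty n :=
  BoundedFormula.iSup fun a : A => letterFormula a.1 i

theorem isQF_ltFormula (i j : Fin n) : (ltFormula i j : (wordLang Γ).BoundedFormula Empty n).IsQF :=
  (BoundedFormula.IsAtomic.rel _ _).isQF

theorem isQF_letterFormula (a : Γ) (i : Fin n) : (letterFormula a i).IsQF :=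
  (BoundedFormula.IsAtomic.rel _ _).isQF

theorem isQF_setFormula [Finite Γ] (A : Set Γ) (i : Fin n) : (setFormula A i).IsQF :=
  isQF_iSup fun _ => isQF_letterFormula _ _

theorem realize_ltFormula {i j : Fin n} {α : Word Γ} {xs : Fin n → α.Pos} :
    (ltFormula i j : (wordLang Γ).BoundedFormula Empty n).Realize default xs ↔
      (xs i).1 < (xs j).1 := Iff.rfl

theorem realize_letterFormula {a : Γ} {i : Fin n} {α : Word Γ} {xs : Fin n → α.Pos} :
    (letterFormula a i).Realize default xs ↔ α.get? (xs i).1 = some a := Iff.rfl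

theorem realize_setFormula [Finite Γ] {A : Set Γ} {i : Fin n} {α : Word Γ}
    {xs : Fin n → α.Pos} : (setFormula A i).Realize default xs ↔
      ∀ b, α.get? (xs i).1 = some b → b ∈ A := by
  rw [setFormula, BoundedFormula.realize_iSup]
  constructor
  · rintro ⟨a, ha⟩ b hb
    rw [realize_letterFormula, hb] at ha
    exact Option.some.inj ha ▸ a.2
  · intro h
    obtain ⟨b, hb⟩ := Option.isSome_iff_exists.1 (xs i).2
    exact ⟨⟨b, h b hb⟩, hb⟩

end Formulas

/-- The condition on the marked positions `x₁ < ⋯ < xₙ` and on one more position. -/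
noncomputable def monomialMatrix [Finite Γ] (l : List (Set Γ × Γ)) (B : Set Γ) :
    (wordLang Γ).BoundedFormula Empty (l.length + 1) :=
  (BoundedFormula.iInf fun i : Fin l.length => letterFormula (l.get i).2 i.castSucc) ⊓
  ((BoundedFormula.iInf fun ij : {ij : Fin l.length × Fin l.length // ij.1 < ij.2} =>
      ltFormula ij.1.1.castSucc ij.1.2.castSucc) ⊓
  ((BoundedFormula.iInf fun i : Fin l.length =>
      (ltFormula (Fin.last _) i.castSucc).imp
        ((BoundedFormula.iInf fun j : {j : Fin l.length // j < i} =>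
          ltFormula j.1.castSucc (Fin.last _)).imp (setFormula (l.get i).1 (Fin.last _)))) ⊓
    (BoundedFormula.iInf fun j : Fin l.length => ltFormula j.castSucc (Fin.last _)).imp
      (setFormula B (Fin.last _))))

theorem isQF_monomialMatrix [Finite Γ] (l : List (Set Γ × Γ)) (B : Set Γ) :
    (monomialMatrix l B).IsQF :=
  (isQF_iInf fun _ => isQF_letterFormula _ _).inf <|
    (isQF_iInf fun _ => isQF_ltFormula _ _).inf <|
      (isQF_iInf fun _ => (isQF_ltFormula _ _).imp <|
        (isQF_iInf fun _ => isQF_ltFormula _ _).imp (isQF_setFormula _ _)).inf <|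
        (isQF_iInf fun _ => isQF_ltFormula _ _).imp (isQF_setFormula _ _)

theorem realize_monomialMatrix [Finite Γ] {l : List (Set Γ × Γ)} {B : Set Γ} {α : Word Γ}
    {xs : Fin l.length → α.Pos} {y : α.Pos} :
    (monomialMatrix l B).Realize default (Fin.snoc xs y : Fin (l.length + 1) → α.Pos) ↔
      (∀ i, α.get? (xs i).1 = some (l.get i).2) ∧ (∀ i j, i < j → (xs i).1 < (xs j).1) ∧
      (∀ i, y.1 < (xs i).1 → (∀ j, j < i → (xs j).1 < y.1) →
        ∀ b, α.get? y.1 = some b → b ∈ (l.get i).1) ∧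
      ((∀ j, (xs j).1 < y.1) → ∀ b, α.get? y.1 = some b → b ∈ B) := by
  simp only [monomialMatrix, BoundedFormula.realize_inf, BoundedFormula.realize_iInf,
    BoundedFormula.realize_imp, realize_letterFormula, realize_ltFormula, realize_setFormula,
    Fin.snoc_castSucc, Fin.snoc_last, Subtype.forall, Prod.forall]

theorem IsSigma2.exs {n : ℕ} {φ : (wordLang Γ).BoundedFormula Empty n} (h : IsSigma2 φ) :
    IsSigma2 φ.exs := by
  induction n with
  | zero => exact h
  | succ n ih => exact ih h.ex

/-- The `Σ₂`-sentence that defines a monomial. -/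
noncomputable def monomialSentence [Finite Γ] (l : List (Set Γ × Γ)) (B : Set Γ) :
    (wordLang Γ).Sentence := (monomialMatrix l B).all.exs

theorem isSigma2_monomialSentence [Finite Γ] (l : List (Set Γ × Γ)) (B : Set Γ) :
    IsSigma2 (monomialSentence l B) :=
  IsSigma2.exs (.of_isUniversal (.all (.of_isQF (isQF_monomialMatrix l B))))

theorem realize_monomialSentence [Finite Γ] {l : List (Set Γ × Γ)} {B : Set Γ} {α : Word Γ} :
    (monomialSentence l B).Realize α.Pos ↔ α ∈ monomial l B := by
  rw [mem_monomial_iff_exists_positions]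
  refine (BoundedFormula.realize_exs (φ := (monomialMatrix l B).all)).trans ?_
  simp only [BoundedFormula.realize_all]
  constructor
  · rintro ⟨xs, h⟩
    have h' := fun y => realize_monomialMatrix.1 (h y)
    refine ⟨fun i => (xs i).1, fun i => (h' (xs i)).1 i, fun i => (h' (xs i)).2.1 i,
      fun y b hy => ?_⟩
    have hy' := h' ⟨y, by rw [hy]; rfl⟩
    exact ⟨fun i h1 h2 => hy'.2.2.1 i h1 h2 b hy, fun h1 => hy'.2.2.2 h1 b hy⟩
  · rintro ⟨x, h1, h2, h3⟩
    refine ⟨fun i => ⟨x i, by rw [h1]; rfl⟩, fun y => realize_monomialMatrix.2 ⟨h1, h2, ?_, ?_⟩⟩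
    · exact fun i h4 h5 b hb => (h3 _ b hb).1 i h4 h5
    · exact fun h4 b hb => (h3 _ b hb).2 h4

theorem bSigma2Definable_of_mem [Finite Γ] {L : Set (Word Γ)} (h : L ∈ monomialCombinations Γ) :
    BSigma2Definable L := by
  refine BooleanSubalgebra.closure_bot_sup_induction (p := fun L _ => BSigma2Definable L)
    ?_ ?_ ?_ ?_ h
  · rintro _ ⟨l, B, rfl⟩
    exact ⟨monomialSentence l B, .of_isSigma2 (isSigma2_monomialSentence l B),
      Set.ext fun _ => realize_monomialSentence.symm⟩
  · exact ⟨⊥, .of_isSigma2 (.of_isUniversal (.of_isQF BoundedFormula.isQF_bot)), rfl⟩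
  · rintro _ - _ - ⟨φ, hφ, rfl⟩ ⟨ψ, hψ, rfl⟩
    refine ⟨φ ⊔ ψ, hφ.or hψ, Set.ext fun α => ?_⟩
    exact (BoundedFormula.realize_sup (φ := φ) (ψ := ψ)).symm
  · rintro _ - ⟨φ, hφ, rfl⟩
    exact ⟨φ.not, hφ.not, rfl⟩

theorem bSigma2DefinableFin_monomial [Finite Γ] (l : List (Set Γ × Γ)) (B : Set Γ) :
    BSigma2DefinableFin {p : FreeMonoid Γ | Word.fin p ∈ monomial l B} :=
  ⟨monomialSentence l B, .of_isSigma2 (isSigma2_monomialSentence l B),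
    Set.ext fun _ => realize_monomialSentence.symm⟩

theorem BSigma2DefinableFin.exists_mem_of_monLE [Finite Γ] {K : Set (FreeMonoid Γ)}
    (h : BSigma2DefinableFin K) : ∃ N : ℕ, ∀ p q : FreeMonoid Γ, MonLE N (Word.fin p) (Word.fin q) →
      MonLE N (Word.fin q) (Word.fin p) → p ∈ K → q ∈ K := by
  obtain ⟨φ, hφ, rfl⟩ := h
  obtain ⟨N, hN⟩ := hφ.exists_monSaturated
  exact ⟨N, fun p q h1 h2 hp => hN _ _ h1 h2 hp⟩

end Logic

/-! ### Infinite concatenations -/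

/-- The product `u₀ ⋯ uₙ₋₁`. -/
def prefixProd (u : ℕ → FreeMonoid Γ) (n : ℕ) : FreeMonoid Γ := ((List.range n).map u).prod

theorem prefixProd_zero (u : ℕ → FreeMonoid Γ) : prefixProd u 0 = 1 := rfl

theorem prefixProd_succ (u : ℕ → FreeMonoid Γ) (n : ℕ) :
    prefixProd u (n + 1) = prefixProd u n * u n := by
  rw [prefixProd, List.range_succ, List.map_append, List.prod_append, prefixProd]
  simp

theorem prefixProd_add (u : ℕ → FreeMonoid Γ) (m n : ℕ) :
    prefixProd u (m + n) = prefixProd u m * prefixProd (fun k => u (m + k)) n := by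
  induction n with
  | zero => rw [Nat.add_zero, prefixProd_zero, mul_one]
  | succ n ih => rw [← add_assoc, prefixProd_succ, ih, prefixProd_succ, mul_assoc]

theorem prefixProd_const (z : FreeMonoid Γ) (n : ℕ) : prefixProd (fun _ => z) n = z ^ n := by
  induction n with
  | zero => rw [prefixProd_zero, pow_zero]
  | succ n ih => rw [prefixProd_succ, ih, pow_succ]

theorem length_prefixProd_mono (u : ℕ → FreeMonoid Γ) :
    Monotone fun n => (prefixProd u n).length :=
  monotone_nat_of_le_succ fun n => by
    rw [prefixProd_succ, FreeMonoid.length_mul]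
    exact Nat.le_add_right _ _

/-- The product `uᵢ ⋯ uⱼ₋₁`. -/
def segProd (u : ℕ → FreeMonoid Γ) (i j : ℕ) : FreeMonoid Γ :=
  prefixProd (fun k => u (i + k)) (j - i)

theorem prefixProd_mul_segProd (u : ℕ → FreeMonoid Γ) {i j : ℕ} (h : i ≤ j) :
    prefixProd u i * segProd u i j = prefixProd u j := by
  rw [segProd, ← prefixProd_add, Nat.add_sub_cancel' h]

theorem segProd_mul_segProd (u : ℕ → FreeMonoid Γ) {i j k : ℕ} (h : i ≤ j) (h' : j ≤ k) :
    segProd u i j * segProd u j k = segProd u i k := by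
  apply mul_left_cancel (a := prefixProd u i)
  rw [← mul_assoc, prefixProd_mul_segProd u h, prefixProd_mul_segProd u h',
    prefixProd_mul_segProd u (h.trans h')]

theorem map_prefixProd_succ {M : Type v} [Monoid M] (h : FreeMonoid Γ →* M)
    {u : ℕ → FreeMonoid Γ} {e : M} (he : e * e = e) (hu : ∀ k, h (u k) = e) (n : ℕ) :
    h (prefixProd u (n + 1)) = e := by
  induction n with
  | zero => rw [prefixProd_succ, prefixProd_zero, one_mul, hu]
  | succ n ih => rw [prefixProd_succ, map_mul, ih, hu, he]

theorem mul_map_prefixProd {M : Type v} [Monoid M] (h : FreeMonoid Γ →* M)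
    {u : ℕ → FreeMonoid Γ} {s e : M} (hs : s * e = s) (hu : ∀ k, h (u k) = e) (n : ℕ) :
    s * h (prefixProd u n) = s := by
  induction n with
  | zero => rw [prefixProd_zero, map_one, mul_one]
  | succ n ih => rw [prefixProd_succ, map_mul, hu, ← mul_assoc, ih, hs]

theorem map_segProd {M : Type v} [Monoid M] (h : FreeMonoid Γ →* M)
    {u : ℕ → FreeMonoid Γ} {e : M} (he : e * e = e) (hu : ∀ k, h (u k) = e) {i j : ℕ}
    (hij : i < j) : h (segProd u i j) = e := by
  obtain ⟨d, hd⟩ := Nat.exists_eq_add_of_lt hij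
  rw [segProd, show j - i = d + 1 by omega]
  exact map_prefixProd_succ h he (fun k => hu _) d

theorem IsInfiniteConcat.exists_eq_smul {u : ℕ → FreeMonoid Γ} {α : Word Γ}
    (h : IsInfiniteConcat u α) (n : ℕ) : ∃ β, α = prefixProd u n • β := h.1 n

theorem IsInfiniteConcat.exists_lt_length {u : ℕ → FreeMonoid Γ} {α : Word Γ}
    (h : IsInfiniteConcat u α) {i : ℕ} (hi : (α.get? i).isSome) :
    ∃ n, i < (prefixProd u n).length := h.2 i hi

theorem IsInfiniteConcat.tail {u : ℕ → FreeMonoid Γ} {α β : Word Γ} {n : ℕ}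
    (h : IsInfiniteConcat u α) (hβ : α = prefixProd u n • β) :
    IsInfiniteConcat (fun k => u (n + k)) β := by
  refine ⟨fun m => ?_, fun i hi => ?_⟩
  · obtain ⟨γ, hγ⟩ := h.exists_eq_smul (n + m)
    rw [hβ, prefixProd_add, mul_smul] at hγ
    exact ⟨γ, Word.smul_cancel hγ⟩
  · have hi' : (α.get? ((prefixProd u n).length + i)).isSome := by
      rwa [hβ, Word.get?_smul_right]
    obtain ⟨m, hm⟩ := h.exists_lt_length hi'
    refine ⟨m, ?_⟩
    change i < (prefixProd (fun k => u (n + k)) m).length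
    have h1 : (prefixProd u m).length ≤ (prefixProd u (n + m)).length :=
      length_prefixProd_mono u (Nat.le_add_left m n)
    rw [prefixProd_add, FreeMonoid.length_mul] at h1
    omega

theorem IsInfiniteConcat.subsequence {u : ℕ → FreeMonoid Γ} {α : Word Γ}
    (h : IsInfiniteConcat u α) {f : ℕ → ℕ} (hf : StrictMono f) (h0 : f 0 = 0) :
    IsInfiniteConcat (fun k => segProd u (f k) (f (k + 1))) α := by
  have key : ∀ n, prefixProd (fun k => segProd u (f k) (f (k + 1))) n = prefixProd u (f n) := by
    intro n
    induction n with
    | zero => rw [h0, prefixProd_zero, prefixProd_zero]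
    | succ n ih => rw [prefixProd_succ, ih, prefixProd_mul_segProd u (hf (Nat.lt_succ_self n)).le]
  refine ⟨fun n => ?_, fun i hi => ?_⟩
  · obtain ⟨β, hβ⟩ := h.exists_eq_smul (f n)
    exact ⟨β, by rw [hβ]; exact congrArg (· • β) (key n).symm⟩
  · obtain ⟨n, hn⟩ := h.exists_lt_length hi
    refine ⟨n, ?_⟩
    change i < (prefixProd _ n).length
    rw [key]
    exact lt_of_lt_of_le hn (length_prefixProd_mono u (hf.id_le n))

theorem IsInfiniteConcat.mem_inftyOf_iff {u : ℕ → FreeMonoid Γ} {α : Word Γ}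
    (h : IsInfiniteConcat u α) {B : Set Γ} : α ∈ inftyOf B ↔ ∀ n, u n ∈ starOf B := by
  constructor
  · intro hα n
    obtain ⟨β, rfl⟩ := h.exists_eq_smul (n + 1)
    rw [prefixProd_succ, smul_mem_inftyOf, mul_mem_starOf] at hα
    exact hα.1.2
  · intro hu i a hi
    have hn : ∀ n, prefixProd u n ∈ starOf B := by
      intro n
      induction n with
      | zero => exact one_mem_starOf B
      | succ n ih =>
        rw [prefixProd_succ, mul_mem_starOf]
        exact ⟨ih, hu n⟩
    obtain ⟨n, hin⟩ := h.exists_lt_length (i := i) (by rw [hi]; rfl)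
    obtain ⟨β, rfl⟩ := h.exists_eq_smul n
    rw [Word.get?_left_iff _ _ hin] at hi
    exact hn n (mem_alph_iff.2 ⟨i, hi⟩)

theorem exists_isInfiniteConcat (α : Word Γ) : ∃ u : ℕ → FreeMonoid Γ, IsInfiniteConcat u α := by
  rcases α with w | s
  · refine ⟨fun n => if n = 0 then w else 1, ?_⟩
    have h : ∀ n, prefixProd (fun n => if n = 0 then w else 1) (n + 1) = w := by
      intro n
      induction n with
      | zero => rw [prefixProd_succ, prefixProd_zero, if_pos rfl, one_mul]
      | succ n ih => rw [prefixProd_succ, ih, if_neg (Nat.succ_ne_zero n), mul_one]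
    refine ⟨fun n => ?_, fun i hi => ⟨1, ?_⟩⟩
    · rcases n with _ | n
      · exact ⟨_, (one_smul _ _).symm⟩
      · refine ⟨Word.fin 1, ?_⟩
        change _ = prefixProd _ (n + 1) • _
        rw [h, Word.smul_fin, mul_one]
    · change i < (prefixProd _ (0 + 1)).length
      rw [h]
      obtain ⟨a, ha⟩ := Option.isSome_iff_exists.1 hi
      exact Word.lt_length ha
  · refine ⟨fun n => FreeMonoid.of (s.get n), ?_⟩
    have h : ∀ n, prefixProd (fun n => FreeMonoid.of (s.get n)) n =
        FreeMonoid.ofList (s.take n) := by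
      intro n
      induction n with
      | zero => rfl
      | succ n ih =>
        rw [prefixProd_succ, ih, Stream'.take_succ', FreeMonoid.ofList_append]
        rfl
    refine ⟨fun n => ⟨Word.inf (s.drop n), ?_⟩, fun i _ => ⟨i + 1, ?_⟩⟩
    · change _ = prefixProd _ n • _
      rw [h, Word.smul_inf]
      exact congrArg Word.inf (Stream'.append_take_drop n s).symm
    · change i < (prefixProd _ (i + 1)).length
      rw [h]
      change i < (s.take (i + 1)).length
      rw [Stream'.length_take]
      exact Nat.lt_succ_self i

theorem omegaWord_eq_pow_smul (z : FreeMonoid Γ) (n : ℕ) : omegaWord z = z ^ n • omegaWord z := by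
  induction n with
  | zero => rw [pow_zero, one_smul]
  | succ n ih =>
    have h := omegaWord_rotate z 1
    rw [mul_one, one_mul] at h
    rw [pow_succ, mul_smul, ← h]
    exact ih

theorem isInfiniteConcat_omegaWord (z : FreeMonoid Γ) :
    IsInfiniteConcat (fun _ => z) (omegaWord z) := by
  refine ⟨fun n => ⟨omegaWord z, ?_⟩, fun i hi => ?_⟩
  · change _ = prefixProd _ n • _
    rw [prefixProd_const]
    exact omegaWord_eq_pow_smul z n
  · by_cases hz : z.toList = []
    · rw [omegaWord, dif_pos hz] at hi
      cases hi
    · refine ⟨i + 1, ?_⟩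
      change i < (prefixProd _ (i + 1)).length
      rw [prefixProd_const]
      have hz' : 0 < z.length := List.length_pos_iff.2 hz
      have : ∀ n, n ≤ (z ^ n).length := by
        intro n
        induction n with
        | zero => exact Nat.zero_le _
        | succ n ih =>
          rw [pow_succ, FreeMonoid.length_mul]
          omega
      exact this (i + 1)

theorem omegaWord_mem_inftyOf {z : FreeMonoid Γ} {B : Set Γ} :
    omegaWord z ∈ inftyOf B ↔ z ∈ starOf B := by
  rw [(isInfiniteConcat_omegaWord z).mem_inftyOf_iff]
  exact forall_const ℕ

theorem exists_prefix_mem_monomial {l : List (Set Γ × Γ)} {B : Set Γ} {α : Word Γ}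
    (h : α ∈ monomial l B) :
    ∃ q β, α = q • β ∧ Word.fin q ∈ monomial l B ∧ β ∈ inftyOf B := by
  induction l generalizing α with
  | nil => exact ⟨1, α, (one_smul _ _).symm, fin_one_mem_monomial.2 rfl, h⟩
  | cons x l ih =>
    obtain ⟨A, a⟩ := x
    obtain ⟨p, hp, γ, hγ, rfl⟩ := mem_monomial_cons.1 h
    obtain ⟨q, β, rfl, hq, hβ⟩ := ih hγ
    refine ⟨p * (FreeMonoid.of a * q), β, ?_, mem_monomial_cons.2 ⟨p, hp, _, hq, rfl⟩, hβ⟩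
    rw [mul_smul, mul_smul]

theorem IsInfiniteConcat.exists_length_le {u : ℕ → FreeMonoid Γ} {α β : Word Γ}
    (h : IsInfiniteConcat u α) {p q : FreeMonoid Γ} (hpq : p • α = q • β) :
    ∃ n, q.length ≤ (p * prefixProd u n).length := by
  rcases le_or_gt q.length p.length with hle | hlt
  · exact ⟨0, by rw [FreeMonoid.length_mul]; omega⟩
  · obtain ⟨w, rfl, rfl⟩ := Word.prefix_of_le hpq hlt.le
    rw [FreeMonoid.length_mul] at hlt
    obtain ⟨n, hn⟩ := h.exists_lt_length (i := w.length - 1) (by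
      rw [Word.get?_smul_left _ _ (by omega), isSome_getElem?]
      change w.length - 1 < w.length
      omega)
    refine ⟨n, ?_⟩
    rw [FreeMonoid.length_mul, FreeMonoid.length_mul]
    omega

/-- The long prefixes of a word in a monomial are in the monomial. -/
theorem IsInfiniteConcat.exists_prefix_mem {u : ℕ → FreeMonoid Γ} {α : Word Γ}
    (h : IsInfiniteConcat u α) {p : FreeMonoid Γ} {l : List (Set Γ × Γ)} {B : Set Γ}
    (hα : p • α ∈ monomial l B) : ∃ n₀, ∀ n, n₀ ≤ n → ∀ γ, α = prefixProd u n • γ →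
      Word.fin (p * prefixProd u n) ∈ monomial l B ∧ γ ∈ inftyOf B := by
  obtain ⟨q, β, hqβ, hq, hβ⟩ := exists_prefix_mem_monomial hα
  obtain ⟨n₀, hn₀⟩ := h.exists_length_le hqβ
  refine ⟨n₀, fun n hn γ hγ => ?_⟩
  have h1 : (prefixProd u n₀).length ≤ (prefixProd u n).length := length_prefixProd_mono u hn
  rw [FreeMonoid.length_mul] at hn₀
  rw [hγ, ← mul_smul] at hqβ
  obtain ⟨w, hw, rfl⟩ := Word.prefix_of_le hqβ.symm (by rw [FreeMonoid.length_mul]; omega)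
  rw [hw]
  obtain ⟨h2, h3⟩ := smul_mem_inftyOf.1 hβ
  exact ⟨monomial_extend_fin hq h2, h3⟩

/-! ### Ramsey factorizations -/

/-- Ramsey's theorem for pairs by a nonprincipal ultrafilter: each `i` has a colour `d i` that it
shares with almost all `j`, and one colour `e` equals `d i` for almost all `i`. A sequence of colour
`e` is then chosen greedily. -/
theorem exists_strictMono_homogeneous {N : Type v} [Finite N] (c : ℕ → ℕ → N) :
    ∃ (f : ℕ → ℕ) (e : N), StrictMono f ∧ ∀ i j, i < j → c (f i) (f j) = e := by
  have h1 : ∀ i, ∃ d, ∀ᶠ j in (Filter.hyperfilter ℕ : Filter ℕ), c i j = d := fun i =>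
    Ultrafilter.eventually_exists_iff.1 (Filter.Eventually.of_forall fun j => ⟨c i j, rfl⟩)
  choose d hd using h1
  obtain ⟨e, he⟩ := Ultrafilter.eventually_exists_iff (P := fun e i => d i = e) |>.1
    (Filter.Eventually.of_forall (f := (Filter.hyperfilter ℕ : Filter ℕ)) fun i => ⟨d i, rfl⟩)
  obtain ⟨f, -, hf⟩ := exists_seq_of_forall_finset_exists (fun i => d i = e)
    (fun i j => i < j ∧ c i j = e) (by
      intro s hs
      have h2 : ∀ᶠ j in (Filter.hyperfilter ℕ : Filter ℕ), ∀ x ∈ s, x < j ∧ c x j = e := by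
        rw [Filter.eventually_all_finset]
        intro x hx
        refine ((Filter.eventually_gt_atTop x).filter_mono Nat.hyperfilter_le_atTop).and ?_
        filter_upwards [hd x] with j hj
        rw [hj]
        exact hs x hx
      exact (he.and h2).exists)
  exact ⟨f, e, fun i j hij => (hf i j hij).1, fun i j hij => (hf i j hij).2⟩

theorem exists_homogeneous_segProd {N : Type v} [Monoid N] [Finite N] (g : FreeMonoid Γ →* N)
    (u : ℕ → FreeMonoid Γ) : ∃ (f : ℕ → ℕ) (e : N), StrictMono f ∧ e * e = e ∧
      ∀ i j, i < j → g (segProd u (f i) (f j)) = e := by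
  obtain ⟨f, e, hf, hfe⟩ := exists_strictMono_homogeneous fun i j => g (segProd u i j)
  refine ⟨f, e, hf, ?_, hfe⟩
  calc e * e = g (segProd u (f 0) (f 1)) * g (segProd u (f 1) (f 2)) := by
        rw [hfe 0 1 Nat.zero_lt_one, hfe 1 2 Nat.one_lt_two]
    _ = e := by
        rw [← map_mul, segProd_mul_segProd u (hf Nat.zero_lt_one).le (hf Nat.one_lt_two).le,
          hfe 0 2 Nat.zero_lt_two]

/-- The last clause records the new factors as blocks of the old ones, so that a second homomorphism
can be evaluated on them. -/
theorem IsInfiniteConcat.exists_ramsey {N : Type v} [Monoid N] [Finite N]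
    (g : FreeMonoid Γ →* N) {u : ℕ → FreeMonoid Γ} {α : Word Γ} (h : IsInfiniteConcat u α) :
    ∃ (n : ℕ) (v : ℕ → FreeMonoid Γ) (β : Word Γ) (e : N), α = prefixProd u n • β ∧
      IsInfiniteConcat v β ∧ e * e = e ∧ g (prefixProd u n) * e = g (prefixProd u n) ∧
      (∀ k, g (v k) = e) ∧ ∀ k, ∃ i j, i < j ∧ v k = segProd u i j := by
  obtain ⟨f, e, hf, he, hfe⟩ := exists_homogeneous_segProd g u
  -- Cutting at `f 1` instead of `f 0` leaves a block of value `e` at the end of the prefix, so the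
  -- prefix absorbs `e`.
  obtain ⟨β, hβ⟩ := h.exists_eq_smul (f 1)
  have hmono : StrictMono fun k => f (k + 1) - f 1 := by
    intro i j hij
    have h1 := hf (Nat.succ_lt_succ hij)
    have h2 : f 1 ≤ f (i + 1) := hf.monotone (Nat.succ_le_succ (Nat.zero_le i))
    dsimp only [Nat.succ_eq_add_one] at h1 h2 ⊢
    omega
  have hseg : ∀ k, segProd (fun k => u (f 1 + k)) (f (k + 1) - f 1) (f (k + 1 + 1) - f 1) =
      segProd u (f (k + 1)) (f (k + 2)) := by
    intro k
    have h1 : f (k + 1) < f (k + 2) := hf (Nat.lt_succ_self (k + 1))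
    have h2 : f 1 ≤ f (k + 1) := hf.monotone (Nat.succ_le_succ (Nat.zero_le k))
    rw [show k + 1 + 1 = k + 2 from rfl]
    rw [segProd, segProd]
    congr 1
    · funext i
      congr 1
      omega
    · omega
  refine ⟨f 1, _, β, e, hβ, (h.tail hβ).subsequence hmono (Nat.sub_self _), he, ?_, ?_, ?_⟩
  · rw [← prefixProd_mul_segProd u (hf Nat.zero_lt_one).le, map_mul, hfe 0 1 Nat.zero_lt_one,
      mul_assoc, he]
  · intro k
    rw [hseg]
    exact hfe _ _ (Nat.lt_succ_self _)
  · exact fun k => ⟨f (k + 1), f (k + 2), hf (Nat.lt_succ_self _), hseg k⟩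

theorem exists_pow_idempotent {N : Type v} [Monoid N] [Finite N] (g : FreeMonoid Γ →* N)
    (z : FreeMonoid Γ) : ∃ n, g (z ^ (n + 1)) * g (z ^ (n + 1)) = g (z ^ (n + 1)) := by
  obtain ⟨f, e, hf, he, hfe⟩ := exists_homogeneous_segProd g fun _ => z
  have h := hf Nat.zero_lt_one
  refine ⟨f 1 - f 0 - 1, ?_⟩
  have h1 : g (z ^ (f 1 - f 0 - 1 + 1)) = e := by
    rw [show f 1 - f 0 - 1 + 1 = f 1 - f 0 by omega, ← hfe 0 1 Nat.zero_lt_one, segProd,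
      prefixProd_const]
  rw [h1, he]

/-! ### The syntactic homomorphism recognizes regular languages -/

theorem smul_omegaWord_mem_pairLang {M : Type v} [Monoid M] {h : FreeMonoid Γ →* M} {s e : M}
    {x z : FreeMonoid Γ} (hx : h x = s) (hz : h z = e) : x • omegaWord z ∈ pairLang h s e :=
  ⟨x, hx, omegaWord z, ⟨_, fun _ => hz, isInfiniteConcat_omegaWord z⟩, rfl⟩

theorem Recognizes.mem_of_mem {M : Type v} [Monoid M] {h : FreeMonoid Γ →* M}
    {L : Set (Word Γ)} (hL : Recognizes h L) {s e : M} (hse : IsLinkedPair s e) {α β : Word Γ}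
    (hα : α ∈ pairLang h s e) (hβ : β ∈ pairLang h s e) (hαL : α ∈ L) : β ∈ L := by
  rw [hL]
  exact ⟨s, e, hse, ⟨α, hα, hαL⟩, hβ⟩

theorem mem_iff_of_syntHom_eq {L : Set (Word Γ)} {x x' z z' : FreeMonoid Γ}
    (hx : syntHom L x = syntHom L x') (hz : syntHom L z = syntHom L z') :
    x • omegaWord z ∈ L ↔ x' • omegaWord z' ∈ L := by
  have h1 : SyntRel L x x' := (Con.eq (syntCon L)).1 hx
  have h2 : SyntRel L z z' := (Con.eq (syntCon L)).1 hz
  have h3 := (h1 1 1 z).1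
  have h4 := (h2 x' 1 1).2
  rw [one_mul, mul_one, one_mul, mul_one] at h3
  rw [mul_one, mul_one] at h4
  exact h3.trans h4

/-- Ramsey's theorem for a recognizing homomorphism `g` replaces a word by an ultimately periodic
one `x z^ω` that `g` does not separate from it; `x` and `z` still have syntactic values `s` and `e`.
For words `x z^ω` the syntactic congruence decides membership in `L`. -/
theorem IsOmegaRegular.mem_iff_of_mem_pairLang {L : Set (Word Γ)} (hL : IsOmegaRegular L)
    {s e : Synt L} (hse : IsLinkedPair s e) {α β : Word Γ}
    (hα : α ∈ pairLang (syntHom L) s e) (hβ : β ∈ pairLang (syntHom L) s e) :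
    α ∈ L ↔ β ∈ L := by
  obtain ⟨M, _, _, g, hg⟩ := hL
  have key : ∀ α ∈ pairLang (syntHom L) s e, ∃ x z, syntHom L x = s ∧ syntHom L z = e ∧
      (α ∈ L ↔ x • omegaWord z ∈ L) := by
    rintro _ ⟨p, hp, α, ⟨u, hu, hα⟩, rfl⟩
    obtain ⟨n, v, β, b, rfl, hv, hb, hgb, hgv, hseg⟩ := hα.exists_ramsey g
    have hlink : IsLinkedPair (g (p * prefixProd u n)) b :=
      ⟨hb, by rw [map_mul, mul_assoc, hgb]⟩
    have h1 : p • prefixProd u n • β ∈ pairLang g (g (p * prefixProd u n)) b :=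
      ⟨_, rfl, β, ⟨v, hgv, hv⟩, (mul_smul _ _ _).symm⟩
    have h2 : (p * prefixProd u n) • omegaWord (v 0) ∈
        pairLang g (g (p * prefixProd u n)) b := smul_omegaWord_mem_pairLang rfl (hgv 0)
    refine ⟨p * prefixProd u n, v 0, ?_, ?_, hg.mem_of_mem hlink h1 h2, hg.mem_of_mem hlink h2 h1⟩
    · rw [map_mul, show syntHom L p = s from hp]
      exact mul_map_prefixProd _ hse.2 hu n
    · obtain ⟨i, j, hij, h3⟩ := hseg 0
      rw [h3]
      exact map_segProd _ hse.1 hu hij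
  obtain ⟨x, z, h1, h2, h3⟩ := key α hα
  obtain ⟨x', z', h1', h2', h3'⟩ := key β hβ
  rw [h3, h3']
  exact mem_iff_of_syntHom_eq (h1.trans h1'.symm) (h2.trans h2'.symm)

/-! ### Saturated languages satisfy the algebraic conditions -/

theorem MonLE.pow {n : ℕ} {p q : FreeMonoid Γ} (h : MonLE n (Word.fin p) (Word.fin q)) (k : ℕ) :
    MonLE n (Word.fin (p ^ k)) (Word.fin (q ^ k)) := by
  induction k with
  | zero => rw [pow_zero, pow_zero]; exact .refl _ _
  | succ k ih => rw [pow_succ, pow_succ]; exact ih.mul h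

theorem exists_pow_mem_of_smul_omegaWord_mem {x z : FreeMonoid Γ} {l : List (Set Γ × Γ)}
    {B : Set Γ} (h : x • omegaWord z ∈ monomial l B) :
    z ∈ starOf B ∧ ∃ n, Word.fin (x * z ^ (n + 1)) ∈ monomial l B := by
  obtain ⟨n, hn⟩ := (isInfiniteConcat_omegaWord z).exists_prefix_mem h
  obtain ⟨h1, h2⟩ := hn (n + 1) (Nat.le_succ n) (omegaWord z)
    (by rw [prefixProd_const]; exact omegaWord_eq_pow_smul z _)
  rw [prefixProd_const] at h1
  exact ⟨omegaWord_mem_inftyOf.1 h2, n, h1⟩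

/-- A monomial containing `x z^ω` already contains some `x z^(k+1)`, with the rest read in its last
alphabet, so only finite powers and alphabets have to be compared. -/
theorem MonLE.smul_omegaWord {n : ℕ} {z z' : FreeMonoid Γ} (h : MonLE n (Word.fin z) (Word.fin z'))
    (x : FreeMonoid Γ) : MonLE n (x • omegaWord z) (x • omegaWord z') := by
  intro l B hl hα
  obtain ⟨h1, k, h2⟩ := exists_pow_mem_of_smul_omegaWord_mem hα
  have h3 : Word.fin (x * z' ^ (k + 1)) ∈ monomial l B :=
    ((MonLE.refl n (Word.fin x)).mul (h.pow (k + 1))) l B hl h2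
  rw [omegaWord_eq_pow_smul z' (k + 1), ← mul_smul]
  exact monomial_extend h3 (omegaWord_mem_inftyOf.2 (h.alph_subset.trans h1))

theorem MonSaturated.syntHom_eq {n : ℕ} {L : Set (Word Γ)} (hL : MonSaturated n L)
    {p q : FreeMonoid Γ} (h : monHom Γ n p = monHom Γ n q) : syntHom L p = syntHom L q := by
  have key : ∀ α β : Word Γ, MonLE n α β → MonLE n β α → (α ∈ L ↔ β ∈ L) :=
    fun α β h1 h2 => ⟨hL α β h1 h2, hL β α h2 h1⟩
  obtain ⟨h1, h2⟩ := monHom_eq_iff.1 h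
  refine (Con.eq (syntCon L)).2 fun x y z => ⟨key _ _ ?_ ?_, key _ _ ?_ ?_⟩
  · exact (((MonLE.refl n _).mul h1).mul (.refl n _)).smul (.refl n _)
  · exact (((MonLE.refl n _).mul h2).mul (.refl n _)).smul (.refl n _)
  · exact (h1.mul (.refl n _)).smul_omegaWord x
  · exact (h2.mul (.refl n _)).smul_omegaWord x

theorem syntHom_surjective (L : Set (Word Γ)) : Function.Surjective (syntHom L) :=
  Con.mk'_surjective

/-- The syntactic monoids of all monomials of degree at most `n` jointly separate words at least as
finely as `monHom Γ n`. Hence `Synt L` is a quotient of the image of `Γ^*` in their product. -/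
theorem MonSaturated.inV2_synt [Finite Γ] {n : ℕ} {L : Set (Word Γ)} (hL : MonSaturated n L) :
    InV2 (Synt L) := by
  -- `InV2` admits alphabets in `Type` only, so the letters are renamed.
  obtain ⟨k, ⟨e⟩⟩ := Finite.exists_equiv_fin Γ
  have hfin : Finite (degLE (Fin k) n) := finite_degLE (Fin k) n
  let K : degLE (Fin k) n → Set (FreeMonoid (Fin k)) := fun i =>
    {p | Word.fin p ∈ monomial i.1.1 i.1.2}
  let φ : FreeMonoid Γ →* FreeMonoid (Fin k) := FreeMonoid.map e
  let Φ : FreeMonoid Γ →* ∀ i, FinSynt (K i) :=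
    MonoidHom.pi fun i => ((finSyntCon (K i)).mk').comp φ
  have aux : ∀ p q : FreeMonoid Γ, Φ p = Φ q → MonLE n (Word.fin p) (Word.fin q) := by
    intro p q h
    have h1 : MonLE n (Word.fin (φ p)) (Word.fin (φ q)) := by
      intro l B hl hp
      have h2 : finSyntCon (K ⟨(l, B), hl⟩) (φ p) (φ q) :=
        (Con.eq _).1 (congrFun h ⟨(l, B), hl⟩)
      have h3 := h2 1 1
      rw [one_mul, mul_one, one_mul, mul_one] at h3
      exact h3.1 hp
    have h4 := h1.map (FreeMonoid.map e.symm)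
    have h5 : ∀ p, FreeMonoid.map e.symm (φ p) = p := by
      intro p
      rw [FreeMonoid.map_map, Equiv.symm_comp_self, FreeMonoid.map_id]
      rfl
    rwa [h5, h5] at h4
  have hker : Con.ker Φ ≤ Con.ker (syntHom L) := fun p q h =>
    hL.syntHom_eq (monHom_eq_iff.2 ⟨aux p q h, aux q p h.symm⟩)
  have hker' : monCon Γ n ≤ Con.ker (syntHom L) := fun p q h =>
    hL.syntHom_eq (monHom_eq_iff.2 h)
  refine ⟨Finite.of_surjective (Con.lift (monCon Γ n) (syntHom L) hker') fun y => ?_,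
    degLE (Fin k) n, hfin, fun _ => Fin k, fun _ => inferInstance, K,
    fun i => bSigma2DefinableFin_monomial _ _, MonoidHom.mrange Φ,
    (Con.lift (Con.ker Φ) (syntHom L) hker).comp
      (Con.quotientKerEquivRange Φ).symm.toMonoidHom, fun y => ?_⟩
  · obtain ⟨p, rfl⟩ := syntHom_surjective L y
    exact ⟨monHom Γ n p, rfl⟩
  · obtain ⟨p, rfl⟩ := syntHom_surjective L y
    refine ⟨Con.quotientKerEquivRange Φ (p : (Con.ker Φ).Quotient), ?_⟩
    rw [MonoidHom.comp_apply]
    refine (congrArg _ ((Con.quotientKerEquivRange Φ).symm_apply_apply _)).trans ?_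
    rfl

/-- Lifting the values of letters through the division and to the free monoids over `A i` gives
homomorphisms between free monoids, and these preserve `MonLE` (`MonLE.map`). A common bound for the
degrees of the `K i` therefore works. -/
theorem InV2.exists_monHom [Finite Γ] {M : Type v} [Monoid M] (hM : InV2 M)
    (h : FreeMonoid Γ →* M) : ∃ n, ∀ p q, monHom Γ n p = monHom Γ n q → h p = h q := by
  obtain ⟨-, ι, hι, A, hA, K, hK, S, f, hf⟩ := hM
  choose N hN using fun i => (hK i).exists_mem_of_monLE
  obtain ⟨n, hn⟩ := (Set.finite_range N).bddAbove
  choose σ hσ using fun a => hf (h (FreeMonoid.of a))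
  choose τ hτ using fun (i : ι) (a : Γ) => Con.mk'_surjective (c := finSyntCon (K i)) ((σ a).1 i)
  have h1 : f.comp (FreeMonoid.lift σ) = h := FreeMonoid.hom_eq fun a => by
    rw [MonoidHom.comp_apply, FreeMonoid.lift_eval_of, hσ]
  have h2 : ∀ i, (finSyntCon (K i)).mk'.comp (FreeMonoid.lift (τ i)) =
      (Pi.evalMonoidHom (fun i => FinSynt (K i)) i).comp (S.subtype.comp (FreeMonoid.lift σ)) :=
    fun i => FreeMonoid.hom_eq fun a => by
      rw [MonoidHom.comp_apply, FreeMonoid.lift_eval_of, hτ, MonoidHom.comp_apply,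
        MonoidHom.comp_apply, FreeMonoid.lift_eval_of]
      rfl
  refine ⟨n, fun p q hpq => ?_⟩
  obtain ⟨hpq1, hpq2⟩ := monHom_eq_iff.1 hpq
  have h3 : FreeMonoid.lift σ p = FreeMonoid.lift σ q := by
    refine Subtype.ext (funext fun i => ?_)
    have hNi : N i ≤ n := hn ⟨i, rfl⟩
    have aux : ∀ p q : FreeMonoid Γ, MonLE n (Word.fin p) (Word.fin q) →
        MonLE n (Word.fin q) (Word.fin p) → ∀ x y : FreeMonoid (A i),
        x * FreeMonoid.lift (τ i) p * y ∈ K i → x * FreeMonoid.lift (τ i) q * y ∈ K i := by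
      intro p q hp hq x y
      refine hN i _ _ ?_ ?_
      · exact (((MonLE.refl _ _).mul (hp.map _)).mul (.refl _ _)).mono hNi
      · exact (((MonLE.refl _ _).mul (hq.map _)).mul (.refl _ _)).mono hNi
    have h4 : (finSyntCon (K i)).mk' (FreeMonoid.lift (τ i) p) =
        (finSyntCon (K i)).mk' (FreeMonoid.lift (τ i) q) :=
      (Con.eq _).2 fun x y => ⟨aux p q hpq1 hpq2 x y, aux q p hpq2 hpq1 x y⟩
    exact (DFunLike.congr_fun (h2 i) p).symm.trans (h4.trans (DFunLike.congr_fun (h2 i) q))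
  rw [← h1, MonoidHom.comp_apply, MonoidHom.comp_apply, h3]

theorem alph_pow_succ (p : FreeMonoid Γ) (n : ℕ) : alph (p ^ (n + 1)) = alph p := by
  induction n with
  | zero => rw [zero_add, pow_one]
  | succ n ih => rw [pow_succ, alph_mul, ih, Set.union_self]

theorem map_pow_succ_of_idempotent {N : Type v} [Monoid N] (g : FreeMonoid Γ →* N)
    {z : FreeMonoid Γ} {e : N} (he : e * e = e) (hz : g z = e) (n : ℕ) : g (z ^ (n + 1)) = e := by
  rw [← prefixProd_const]
  exact map_prefixProd_succ g he (fun _ => hz) n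

/-- With `s x = t`, `t y = s` and idempotent powers `E`, `F`, `Z` of `ê`, `f̂` and `E x F y`, the
words `r Z E^ω` and `r Z E x F^ω` represent the two pairs. Either lies in a monomial of degree at
most `n` with last alphabet `B` exactly when `C ⊆ B` and `r Z` is in the monomial. Saturation then
equates their membership in `L`. -/
theorem MonSaturated.pairLang_subset_iff [Finite Γ] {n : ℕ} {L : Set (Word Γ)}
    (hL : MonSaturated n L) (hreg : IsOmegaRegular L) {s e t f : Synt L}
    (hse : IsLinkedPair s e) (htf : IsLinkedPair t f) {C : Set Γ} {e' f' : FreeMonoid Γ}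
    (he' : syntHom L e' = e) (hf' : syntHom L f' = f) (heC : alph e' = C) (hfC : alph f' = C)
    (hst : (fun x => s * x) '' (syntHom L '' starOf C) =
      (fun x => t * x) '' (syntHom L '' starOf C)) :
    pairLang (syntHom L) s e ⊆ L ↔ pairLang (syntHom L) t f ⊆ L := by
  have h1 : t ∈ (fun x => s * x) '' (syntHom L '' starOf C) := by
    rw [hst]
    exact ⟨1, ⟨1, one_mem_starOf C, map_one _⟩, mul_one t⟩
  have h2 : s ∈ (fun x => t * x) '' (syntHom L '' starOf C) := by
    rw [← hst]
    exact ⟨1, ⟨1, one_mem_starOf C, map_one _⟩, mul_one s⟩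
  obtain ⟨_, ⟨x, hx, rfl⟩, hsx⟩ := h1
  obtain ⟨_, ⟨y, hy, rfl⟩, hty⟩ := h2
  dsimp only at hsx hty
  obtain ⟨r, hr⟩ := syntHom_surjective L s
  obtain ⟨k₁, hk₁⟩ := exists_pow_idempotent (monHom Γ n) e'
  obtain ⟨k₂, hk₂⟩ := exists_pow_idempotent (monHom Γ n) f'
  set E := e' ^ (k₁ + 1) with hE
  set F := f' ^ (k₂ + 1) with hF
  have hEe : syntHom L E = e := map_pow_succ_of_idempotent _ hse.1 he' _
  have hFf : syntHom L F = f := map_pow_succ_of_idempotent _ htf.1 hf' _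
  have hEC : alph E = C := (alph_pow_succ _ _).trans heC
  have hFC : alph F = C := (alph_pow_succ _ _).trans hfC
  -- A cycle from `s` through `t` back to `s`, passing through both idempotents.
  set z := E * x * F * y with hz
  obtain ⟨k₃, hk₃⟩ := exists_pow_idempotent (monHom Γ n) z
  set Z := z ^ (k₃ + 1) with hZ
  have hsz : s * syntHom L z = s := by
    rw [hz, map_mul, map_mul, map_mul, hEe, hFf, ← mul_assoc, ← mul_assoc, ← mul_assoc, hse.2, hsx,
      htf.2, hty]
  have hrZ : syntHom L (r * Z) = s := by
    rw [map_mul, hr, hZ, ← prefixProd_const]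
    exact mul_map_prefixProd _ hsz (fun _ => rfl) _
  have hrZE : syntHom L (r * Z * (E * x)) = t := by
    rw [map_mul, hrZ, map_mul, hEe, ← mul_assoc, hse.2, hsx]
  have hzC : z ∈ starOf C := by
    rw [hz, mul_mem_starOf, mul_mem_starOf, mul_mem_starOf]
    exact ⟨⟨⟨hEC.le, hx⟩, hFC.le⟩, hy⟩
  have hpow : ∀ (m : ℕ) (p : FreeMonoid Γ), p ∈ starOf C → p ^ m ∈ starOf C := by
    intro m p hp
    induction m with
    | zero => exact one_mem_starOf C
    | succ m ih => rw [pow_succ, mul_mem_starOf]; exact ⟨ih, hp⟩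
  -- a monomial contains one of the two words if and only if it contains `r Z` and can loop in `C`
  have hZZ : ∀ {l : List (Set Γ × Γ)} {B : Set Γ}, l.length ≤ n →
      Word.fin (r * (Z * Z)) ∈ monomial l B → Word.fin (r * Z) ∈ monomial l B := by
    intro l B hl h
    rw [← map_mul] at hk₃
    exact ((MonLE.refl n (Word.fin r)).mul (monHom_eq_iff.1 hk₃).1) l B hl h
  have hpowLE : ∀ {p : FreeMonoid Γ}, monHom Γ n p * monHom Γ n p = monHom Γ n p → ∀ m : ℕ,
      MonLE n (Word.fin (p ^ (m + 1))) (Word.fin p) := fun {p} hp m =>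
    (monHom_eq_iff.1 (map_pow_succ_of_idempotent (monHom Γ n) hp rfl m)).1
  have key₁ : ∀ (l : List (Set Γ × Γ)) (B : Set Γ), l.length ≤ n →
      ((r * Z) • omegaWord E ∈ monomial l B ↔ C ⊆ B ∧ Word.fin (r * Z) ∈ monomial l B) := by
    intro l B hl
    constructor
    · intro h
      obtain ⟨h3, m, h4⟩ := exists_pow_mem_of_smul_omegaWord_mem h
      have hCB : C ⊆ B := hEC ▸ h3
      have h5 := ((MonLE.refl n (Word.fin (r * Z))).mul (hpowLE hk₁ m)) l B hl h4
      -- This factor over `C` completes `r Z E` to `r Z Z`, which idempotency of `Z` shrinks to `r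
      -- Z`.
      have h6 := monomial_extend_fin h5 (q := x * F * y * z ^ k₃) (starOf_mono hCB (by
        rw [mul_mem_starOf, mul_mem_starOf, mul_mem_starOf]
        exact ⟨⟨⟨hx, hFC.le⟩, hy⟩, hpow _ _ hzC⟩))
      refine ⟨hCB, hZZ hl ?_⟩
      convert h6 using 2
      conv_lhs => rw [show Z * Z = Z * (z * z ^ k₃) by rw [← pow_succ', ← hZ]]
      rw [hz]
      simp only [mul_assoc]
    · rintro ⟨hCB, h⟩
      exact monomial_extend h (omegaWord_mem_inftyOf.2 (hEC.le.trans hCB))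
  have key₂ : ∀ (l : List (Set Γ × Γ)) (B : Set Γ), l.length ≤ n →
      ((r * Z * (E * x)) • omegaWord F ∈ monomial l B ↔
        C ⊆ B ∧ Word.fin (r * Z) ∈ monomial l B) := by
    intro l B hl
    constructor
    · intro h
      obtain ⟨h3, m, h4⟩ := exists_pow_mem_of_smul_omegaWord_mem h
      have hCB : C ⊆ B := hFC ▸ h3
      have h5 := ((MonLE.refl n (Word.fin (r * Z * (E * x)))).mul (hpowLE hk₂ m)) l B hl h4
      have h6 := monomial_extend_fin h5 (q := y * z ^ k₃) (starOf_mono hCB (by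
        rw [mul_mem_starOf]
        exact ⟨hy, hpow _ _ hzC⟩))
      refine ⟨hCB, hZZ hl ?_⟩
      convert h6 using 2
      conv_lhs => rw [show Z * Z = Z * (z * z ^ k₃) by rw [← pow_succ', ← hZ]]
      rw [hz]
      simp only [mul_assoc]
    · rintro ⟨hCB, h⟩
      rw [mul_smul]
      refine monomial_extend h (smul_mem_inftyOf.2 ⟨?_, omegaWord_mem_inftyOf.2 (hFC.le.trans hCB)⟩)
      rw [mul_mem_starOf]
      exact ⟨hEC.le.trans hCB, starOf_mono hCB hx⟩
  have hiff : (r * Z) • omegaWord E ∈ L ↔ (r * Z * (E * x)) • omegaWord F ∈ L := by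
    constructor
    · exact hL _ _ (fun l B hl h => (key₂ l B hl).2 ((key₁ l B hl).1 h))
        (fun l B hl h => (key₁ l B hl).2 ((key₂ l B hl).1 h))
    · exact hL _ _ (fun l B hl h => (key₁ l B hl).2 ((key₂ l B hl).1 h))
        (fun l B hl h => (key₂ l B hl).2 ((key₁ l B hl).1 h))
  have hw₁ : (r * Z) • omegaWord E ∈ pairLang (syntHom L) s e :=
    smul_omegaWord_mem_pairLang hrZ hEe
  have hw₂ : (r * Z * (E * x)) • omegaWord F ∈ pairLang (syntHom L) t f :=
    smul_omegaWord_mem_pairLang hrZE hFf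
  constructor
  · exact fun h β hβ => (hreg.mem_iff_of_mem_pairLang htf hβ hw₂).2 (hiff.1 (h hw₁))
  · exact fun h β hβ => (hreg.mem_iff_of_mem_pairLang hse hβ hw₁).2 (hiff.2 (h hw₂))

/-! ### Stable factorizations -/

theorem prefixProd_succ_left (v : ℕ → FreeMonoid Γ) (n : ℕ) :
    prefixProd v (n + 1) = v 0 * prefixProd (fun k => v (1 + k)) n := by
  rw [add_comm, prefixProd_add, prefixProd_succ, prefixProd_zero, one_mul]

/-- If a monomial reads more factors with all letters of `C` than its degree, then it reads one
of them within a single alphabet. -/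
theorem exists_loop_of_prefixProd {C : Set Γ} {m : ℕ} {v : ℕ → FreeMonoid Γ}
    (hv : ∀ i, C ⊆ alph (v i)) {w : FreeMonoid Γ} {l : List (Set Γ × Γ)} {B : Set Γ}
    (hl : l.length < m) (h : Word.fin (w * prefixProd v m) ∈ monomial l B) :
    ∃ E₁ E₂ l₁ r, prefixProd v m = E₁ * E₂ ∧ l = l₁ ++ r ∧ C ⊆ firstSet r B ∧
      Word.fin (w * E₁) ∈ monomial l₁ (firstSet r B) ∧ Word.fin E₂ ∈ monomial r B := by
  induction m generalizing v w l with
  | zero => exact absurd hl (Nat.not_lt_zero _)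
  | succ m ih =>
    rw [prefixProd_succ_left] at h ⊢
    rw [← Word.smul_fin] at h
    obtain ⟨l₀, r₀, rfl, h1, h2⟩ := monomial_split h
    rw [← Word.smul_fin] at h2
    obtain ⟨l₁, r, rfl, h3, h4⟩ := monomial_split h2
    -- Either the factor `v 0` is read without meeting a mark, which is the loop, or it uses up a
    -- mark and the remaining degree drops.
    rcases l₁ with _ | ⟨x, l₁⟩
    · exact ⟨_, _, l₀, r, rfl, rfl, (hv 0).trans (fin_mem_inftyOf.1 h3),
        monomial_extend h1 h3, h4⟩
    · rw [← one_mul (prefixProd _ m)] at h4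
      obtain ⟨E₁, E₂, l₂, r', h5, rfl, h6, h7, h8⟩ := ih (fun i => hv (1 + i))
        (by simp only [List.length_append, List.length_cons] at hl; omega) h4
      refine ⟨v 0 * E₁, E₂, l₀ ++ (x :: l₁ ++ l₂), r', by rw [h5, mul_assoc],
        by simp only [List.append_assoc], h6, ?_, h8⟩
      rw [one_mul] at h7
      rw [← Word.smul_fin, ← Word.smul_fin]
      rw [← List.append_assoc, firstSet_append] at h1
      rw [firstSet_append] at h3
      exact monomial_append h1 (monomial_append h3 h7)

/-- A factorization `α = u E γ` whose tail `E γ` is over the alphabet `C` of `E`, where `E` is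
idempotent and absorbed by `u` up to monomials of degree at most `k`, occurs again and again
and reads a loop, and where `u` is so long that it is in all monomials of degree at most `k` that
contain `α` and whose last alphabet contains `C`. -/
structure IsStable (k : ℕ) (C : Set Γ) (α : Word Γ) (u E : FreeMonoid Γ) : Prop where
  alph_eq : alph E = C
  idem : monHom Γ k E * monHom Γ k E = monHom Γ k E
  absorb : monHom Γ k u * monHom Γ k E = monHom Γ k u
  loop : ∀ (w : FreeMonoid Γ) (l : List (Set Γ × Γ)) (B : Set Γ), l.length ≤ k →
    Word.fin (w * E) ∈ monomial l B → ∃ E₁ E₂ l₁ r, E = E₁ * E₂ ∧ l = l₁ ++ r ∧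
      C ⊆ firstSet r B ∧ Word.fin (w * E₁) ∈ monomial l₁ (firstSet r B) ∧
      Word.fin E₂ ∈ monomial r B
  split : ∃ γ ∈ inftyOf C, α = u • E • γ
  recur : ∀ (q : FreeMonoid Γ) (γ : Word Γ), α = q • γ →
    ∃ (x E' : FreeMonoid Γ) (δ : Word Γ), γ = x • E' • δ ∧ monHom Γ k E' = monHom Γ k E
  long : ∀ (l : List (Set Γ × Γ)) (A : Set Γ), l.length ≤ k → C ⊆ A → α ∈ monomial l A →
    Word.fin u ∈ monomial l A
  mem_pairLang : α ∈ pairLang (monHom Γ k) (monHom Γ k u) (monHom Γ k E)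

theorem alph_eq_of_monHom_eq {k : ℕ} {p q : FreeMonoid Γ} (h : monHom Γ k p = monHom Γ k q) :
    alph p = alph q :=
  Set.Subset.antisymm (monHom_eq_iff.1 h).2.alph_subset (monHom_eq_iff.1 h).1.alph_subset

theorem alph_prefixProd_succ {C : Set Γ} {v : ℕ → FreeMonoid Γ} (hv : ∀ i, alph (v i) = C)
    (n : ℕ) : alph (prefixProd v (n + 1)) = C := by
  induction n with
  | zero => rw [prefixProd_succ, prefixProd_zero, one_mul, hv]
  | succ n ih => rw [prefixProd_succ, alph_mul, ih, hv, Set.union_self]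

/-- Apply Ramsey's theorem to `monHom Γ k`. The prefix `u` is prolonged beyond the thresholds of all
monomials of degree at most `k`, and `E` is the block of the next `k + 1` factors, too many for `k`
marks to meet each of them. -/
theorem exists_isStable [Finite Γ] (k : ℕ) (α : Word Γ) : ∃ C u E, IsStable k C α u E := by
  obtain ⟨u, hu⟩ := exists_isInfiniteConcat α
  obtain ⟨n, v, β, e, hα, hv, he, hpe, hve, -⟩ := hu.exists_ramsey (monHom Γ k)
  set P := prefixProd u n
  have hvC : ∀ i, alph (v i) = alph (v 0) :=
    fun i => alph_eq_of_monHom_eq ((hve i).trans (hve 0).symm)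
  -- For each monomial containing `α`, a threshold beyond which the prefixes of `α` belong to it.
  have hn₀ : ∀ x : List (Set Γ × Γ) × Set Γ, ∃ n₀, α ∈ monomial x.1 x.2 → ∀ n, n₀ ≤ n →
      Word.fin (P * prefixProd v n) ∈ monomial x.1 x.2 := by
    intro x
    by_cases hx : α ∈ monomial x.1 x.2
    · rw [hα] at hx
      obtain ⟨n₀, hn₀⟩ := hv.exists_prefix_mem hx
      refine ⟨n₀, fun _ n hn => ?_⟩
      obtain ⟨γ, hγ⟩ := hv.exists_eq_smul n
      exact (hn₀ n hn γ hγ).1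
    · exact ⟨0, fun h => absurd h hx⟩
  choose n₀ hn₀ using hn₀
  obtain ⟨m, hm⟩ := ((finite_degLE Γ k).image n₀).bddAbove
  obtain ⟨γ, hγ⟩ := hv.exists_eq_smul m
  have hγv := hv.tail hγ
  obtain ⟨δ, hδ⟩ := hγv.exists_eq_smul (k + 1)
  have hE : ∀ i, monHom Γ k (prefixProd (fun j => v (i + j)) (k + 1)) = e :=
    fun i => map_prefixProd_succ _ he (fun _ => hve _) k
  have hu' : monHom Γ k (P * prefixProd v m) = monHom Γ k P := by
    rw [map_mul]
    exact mul_map_prefixProd _ hpe hve m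
  refine ⟨alph (v 0), P * prefixProd v m, prefixProd (fun j => v (m + j)) (k + 1),
    alph_prefixProd_succ (fun i => hvC _) k, by rw [hE, he], by rw [hE, hu', hpe], ?_,
    ⟨δ, ?_, ?_⟩, ?_, ?_, ?_⟩
  · exact fun w l B hl h =>
      exists_loop_of_prefixProd (fun i => (hvC _).ge) (Nat.lt_succ_of_le hl) h
  · have h1 : γ ∈ inftyOf (alph (v 0)) := hγv.mem_inftyOf_iff.2 fun i => (hvC _).le
    rw [hδ, smul_mem_inftyOf] at h1
    exact h1.2
  · rw [hα, hγ, mul_smul, ← hδ]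
  · intro q ε hq
    rw [hα] at hq
    obtain ⟨i, hi⟩ := hv.exists_length_le hq
    obtain ⟨ζ, hζ⟩ := hv.exists_eq_smul i
    rw [hζ, ← mul_smul] at hq
    obtain ⟨x, -, rfl⟩ := Word.prefix_of_le hq.symm hi
    obtain ⟨η, hη⟩ := (hv.tail hζ).exists_eq_smul (k + 1)
    exact ⟨x, _, η, by rw [hη], by rw [hE, hE]⟩
  · intro l A hl _ hlA
    exact hn₀ (l, A) hlA m (hm ⟨(l, A), hl, rfl⟩)
  · exact ⟨_, rfl, γ, ⟨_, fun i => (hve _).trans (hE m).symm, hγv⟩, by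
      rw [mul_smul, ← hγ, ← hα]⟩

theorem eq_fin_one_of_mem_inftyOf_empty {α : Word Γ} (h : α ∈ inftyOf (∅ : Set Γ)) :
    α = Word.fin 1 := by
  by_contra hne
  obtain ⟨a, γ, rfl⟩ := Word.exists_cons hne
  exact h 0 a (Word.get?_of_smul_zero a γ)

theorem smul_ne_fin_one {p : FreeMonoid Γ} {α : Word Γ} (h : α ≠ Word.fin 1) :
    p • α ≠ Word.fin 1 := by
  obtain ⟨a, γ, rfl⟩ := Word.exists_cons h
  intro h1
  have := Word.get?_split p a γ
  rw [h1] at this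
  exact absurd (Word.lt_length this) (Nat.not_lt_zero _)

/-- Finiteness is visible in degree one: a nonempty finite word ends in some `a`, so it lies in `Γ^*
a ∅^∞`, which has only finite words. The empty word is handled by `∅^∞`. -/
theorem MonLE.exists_fin_of_fin {p : FreeMonoid Γ} {β : Word Γ} (h : MonLE 1 (Word.fin p) β) :
    ∃ q, β = Word.fin q := by
  rcases FreeMonoid.inductionOn (motive := fun p => p = 1 ∨ ∃ q a, p = q * FreeMonoid.of a) p
    (Or.inl rfl) (fun a => Or.inr ⟨1, a, (one_mul _).symm⟩) (fun p q hp hq => by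
      rcases hq with rfl | ⟨q, a, rfl⟩
      · rwa [mul_one]
      · exact Or.inr ⟨p * q, a, (mul_assoc _ _ _).symm⟩) with rfl | ⟨q, a, rfl⟩
  · exact ⟨1, eq_fin_one_of_mem_inftyOf_empty (h.mem_inftyOf (fin_one_mem_monomial.2 rfl :
      Word.fin 1 ∈ monomial [] ∅))⟩
  · obtain ⟨q', -, γ, hγ, rfl⟩ := mem_monomial_cons.1 (h [(Set.univ, a)] ∅ le_rfl
      (mem_monomial_cons.2 ⟨q, Set.subset_univ _, Word.fin 1, fin_one_mem_monomial.2 rfl, by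
        rw [Word.smul_fin, Word.smul_fin, mul_one]⟩))
    rw [eq_fin_one_of_mem_inftyOf_empty hγ]
    exact ⟨_, rfl⟩

/-! ### Comparison of stable factorizations -/

namespace IsStable

variable {k : ℕ} {C D : Set Γ} {α β : Word Γ} {u E v F : FreeMonoid Γ}

theorem mem_of_mul_mem (h : IsStable k C α u E) {l : List (Set Γ × Γ)} {B : Set Γ}
    (hl : l.length ≤ k) : Word.fin (u * E) ∈ monomial l B ↔ Word.fin u ∈ monomial l B := by
  have h1 := h.absorb
  rw [← map_mul, monHom_eq_iff] at h1
  exact ⟨h1.1 l B hl, h1.2 l B hl⟩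

/-- Recurrence puts a nonempty factor into every tail. This supplies the nonemptiness required for
splitting. -/
theorem nonempty_of_ne (h : IsStable k C α u E) (hC : C.Nonempty) {q : FreeMonoid Γ} {γ : Word Γ}
    (hα : α = q • γ) : γ ≠ Word.fin 1 := by
  obtain ⟨x, E', δ, rfl, hE'⟩ := h.recur q γ hα
  obtain ⟨a, ha⟩ := hC
  have h1 : E' ≠ 1 := by
    rintro rfl
    rw [← h.alph_eq, ← alph_eq_of_monHom_eq hE', alph_one] at ha
    exact ha
  refine smul_ne_fin_one fun h2 => h1 ?_
  have h3 : E' • δ ∈ inftyOf (∅ : Set Γ) := h2 ▸ fin_mem_inftyOf.2 (one_mem_starOf ∅)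
  exact Word.fin.inj (eq_fin_one_of_mem_inftyOf_empty
    (fin_mem_inftyOf.2 (smul_mem_inftyOf.1 h3).1))

theorem eq_fin (h : IsStable k ∅ α u E) : α = Word.fin u := by
  obtain ⟨γ, hγ, rfl⟩ := h.split
  have h1 : E • γ ∈ inftyOf (∅ : Set Γ) := smul_mem_inftyOf.2 ⟨h.alph_eq.le, hγ⟩
  rw [eq_fin_one_of_mem_inftyOf_empty h1, Word.smul_fin, mul_one]

/-- The tail `E γ` of `α` is over `C` and transfers to a tail of `β` over `C`. A factor equivalent
to `F` occurs in that tail, and its alphabet is `D`. -/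
theorem alph_subset (hα : IsStable k C α u E) (hβ : IsStable k D β v F) {N : ℕ} (hN1 : 1 ≤ N)
    (hN : ∀ (p : FreeMonoid Γ) (γ β : Word Γ), γ ≠ Word.fin 1 → MonLE N (p • γ) β →
      ∃ q δ, β = q • δ ∧ MonLE k (Word.fin p) (Word.fin q) ∧ MonLE k γ δ)
    (h : MonLE N α β) : D ⊆ C := by
  have key : ∀ (q : FreeMonoid Γ) (δ : Word Γ), β = q • δ → δ ∈ inftyOf C → D ⊆ C := by
    intro q δ hqδ hδ
    obtain ⟨x, F', ε, rfl, hF'⟩ := hβ.recur q δ hqδ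
    rw [← hβ.alph_eq, ← alph_eq_of_monHom_eq hF']
    exact (smul_mem_inftyOf.1 (smul_mem_inftyOf.1 hδ).2).1
  -- For `C = ∅` the word `α` is finite and there is no nonempty tail to split off; degree one then
  -- forces `β` to be finite.
  rcases C.eq_empty_or_nonempty with rfl | hC
  · have h1 := hα.eq_fin
    subst h1
    obtain ⟨q, rfl⟩ := (h.mono hN1).exists_fin_of_fin
    exact key q (Word.fin 1) (by rw [Word.smul_fin, mul_one])
      (fin_mem_inftyOf.2 (one_mem_starOf _))
  · obtain ⟨γ, hγ, hαγ⟩ := hα.split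
    have h1 := hα.nonempty_of_ne hC hαγ
    rw [hαγ] at h
    obtain ⟨q, δ, rfl, -, h2⟩ := hN _ _ _ h1 h
    exact key q δ rfl (h2.mem_inftyOf (smul_mem_inftyOf.2 ⟨hα.alph_eq.le, hγ⟩))

/-- A monomial containing `u` contains `u E` and reads a loop inside `E = E₁ E₂`. Its part before
the loop, with the loop alphabet as last one, contains `α`, hence `β`, hence `v` by `long`. The
factor `y E₁` over `C` is then absorbed by the loop, and `E₂` finishes the monomial. -/
theorem monLE_mul (hα : IsStable k C α u E) (hβ : IsStable k C β v F) (h : MonLE k α β)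
    {y : FreeMonoid Γ} (hy : y ∈ starOf C) : MonLE k (Word.fin u) (Word.fin (v * y * E)) := by
  intro l B hl hu
  obtain ⟨E₁, E₂, l₁, r, h1, rfl, h2, h3, h4⟩ := hα.loop u l B hl ((hα.mem_of_mul_mem hl).2 hu)
  have hE : E₁ ∈ starOf C ∧ E₂ ∈ starOf C := by
    rw [← mul_mem_starOf, ← h1]
    exact hα.alph_eq.le
  rw [List.length_append] at hl
  obtain ⟨γ, hγ, hαγ⟩ := hα.split
  have h5 : α ∈ monomial l₁ (firstSet r B) := by
    rw [hαγ, h1, mul_smul, ← mul_smul]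
    exact monomial_extend h3
      (inftyOf_mono h2 (smul_mem_inftyOf.2 ⟨hE.2, hγ⟩))
  have h6 := hβ.long l₁ _ (by omega) h2 (h l₁ _ (by omega) h5)
  rw [h1, ← mul_assoc, mul_assoc v, ← Word.smul_fin]
  exact monomial_append (monomial_extend_fin h6
    (starOf_mono h2 (mul_mem_starOf.2 ⟨hy, hE.1⟩))) h4

/-- A monomial containing `u E z E` reads a loop in each `E`. Its part up to the second loop
contains `α`, by following the factorization `q E₁ z E₂ γ`, so it contains `u` by `long`. Reading
one more `E` through the second loop shows that the whole monomial contains `u E`, and absorption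
gives `u`. -/
theorem mul_monLE (hα : IsStable k C α u E) {q E₁ E₂ z : FreeMonoid Γ} {γ : Word Γ}
    (hq : MonLE k (Word.fin u) (Word.fin q)) (hE₁ : MonLE k (Word.fin E) (Word.fin E₁))
    (hE₂ : MonLE k (Word.fin E) (Word.fin E₂)) (hγ : γ ∈ inftyOf C)
    (h : α = (q * E₁ * z * E₂) • γ) : MonLE k (Word.fin (u * E * (z * E))) (Word.fin u) := by
  intro l B hl hu
  rw [← Word.smul_fin] at hu
  obtain ⟨l₀, r₀, rfl, h1, h2⟩ := monomial_split hu
  simp only [List.length_append] at hl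
  obtain ⟨D₁, D₂, l₁, r₁, h3, rfl, h4, h5, h6⟩ := hα.loop u l₀ _ (by omega) h1
  obtain ⟨D₃, D₄, l₂, r₂, h7, rfl, h8, h9, h10⟩ := hα.loop z r₀ B (by omega) h2
  simp only [List.length_append] at hl
  have hD₁ : D₁ ∈ starOf C ∧ D₂ ∈ starOf C := by
    rw [← mul_mem_starOf, ← h3]
    exact hα.alph_eq.le
  have hD₂ : D₃ ∈ starOf C ∧ D₄ ∈ starOf C := by
    rw [← mul_mem_starOf, ← h7]
    exact hα.alph_eq.le
  rw [firstSet_append] at h4 h5 h6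
  obtain ⟨δ, hδ, hαδ⟩ := hα.split
  have h11 : α ∈ monomial l₁ (firstSet r₁ (firstSet l₂ (firstSet r₂ B))) := by
    rw [hαδ, h3, mul_smul, ← mul_smul]
    exact monomial_extend h5 (inftyOf_mono h4 (smul_mem_inftyOf.2 ⟨hD₁.2, hδ⟩))
  have h12 := hq l₁ _ (by omega) (hα.long l₁ _ (by omega) h4 h11)
  have h13 : Word.fin E₁ ∈ monomial r₁ (firstSet l₂ (firstSet r₂ B)) := by
    refine hE₁ r₁ _ (by omega) ?_
    rw [h3, ← Word.smul_fin]
    exact monomial_prepend (starOf_mono h4 hD₁.1) h6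
  have h14 : Word.fin (z * E₂) ∈ monomial l₂ (firstSet r₂ B) := by
    refine ((MonLE.refl k (Word.fin z)).mul hE₂) l₂ _ (by omega) ?_
    rw [h7, ← mul_assoc]
    exact monomial_extend_fin h9 (starOf_mono h8 hD₂.2)
  have h15 : α ∈ monomial (l₁ ++ (r₁ ++ l₂)) (firstSet r₂ B) := by
    rw [h]
    refine monomial_extend ?_ (inftyOf_mono h8 hγ)
    rw [mul_assoc, mul_assoc, ← Word.smul_fin, ← Word.smul_fin]
    rw [← firstSet_append] at h12
    exact monomial_append h12 (monomial_append h13 h14)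
  have h16 := hα.long _ _ (by simp only [List.length_append]; omega) h8 h15
  rw [← hα.mem_of_mul_mem (by simp only [List.length_append]; omega), h7, ← mul_assoc,
    ← Word.smul_fin]
  have h17 := monomial_append (monomial_extend_fin h16 (starOf_mono h8 hD₂.1)) h10
  simpa only [List.append_assoc] using h17

/-- For words that agree on the monomials of large degree, the prefixes of stable factorizations
agree on the monomials of degree at most `k`, up to a factor over the alphabet of the tails. -/
theorem exists_monHom_eq (hα : IsStable k C α u E) (hβ : IsStable k C β v F) {S : ℕ → ℕ}
    (hS : ∀ n, n ≤ S n) (hsplit : ∀ (n : ℕ) (p : FreeMonoid Γ) (γ β : Word Γ), γ ≠ Word.fin 1 →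
      MonLE (S n) (p • γ) β →
      ∃ q δ, β = q • δ ∧ MonLE n (Word.fin p) (Word.fin q) ∧ MonLE n γ δ)
    (h : MonLE (S (S (S (S k)))) α β) (h' : MonLE (S (S (S (S k)))) β α) :
    ∃ x ∈ starOf C, monHom Γ k u = monHom Γ k (v * x) := by
  have hk : k ≤ S k := hS k
  have hk₂ : k ≤ S (S k) := hk.trans (hS _)
  -- Each application of `S` pays for one cut. The transfer from `β` back to `α` needs four cuts,
  -- the transfer from `α` to `β` only two.
  have hk₃ : k ≤ S (S (S k)) := hk₂.trans (hS _)
  have hk₄ : S (S k) ≤ S (S (S (S k))) := (hS _).trans (hS _)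
  have hkα : MonLE k α β := h.mono (hk₂.trans hk₄)
  have hkβ : MonLE k β α := h'.mono (hk₂.trans hk₄)
  rcases C.eq_empty_or_nonempty with rfl | hC
  · rw [hα.eq_fin, hβ.eq_fin] at hkα hkβ
    exact ⟨1, one_mem_starOf _, by rw [mul_one]; exact monHom_eq_iff.2 ⟨hkα, hkβ⟩⟩
  -- locate `E` in `β`, behind a prefix that lies above `u`
  obtain ⟨γ₀, hγ₀, hαγ⟩ := hα.split
  have hne := hα.nonempty_of_ne hC (q := u * E) (γ := γ₀) (by rw [mul_smul, ← hαγ])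
  have h1 := h.mono hk₄
  rw [hαγ] at h1
  obtain ⟨q₁, δ₁, hβδ, h2, h3⟩ := hsplit _ _ _ _ (smul_ne_fin_one hne) h1
  obtain ⟨E₁, β₁, rfl, h4, h5⟩ := hsplit _ _ _ _ hne h3
  have hβ₁ := h5.mem_inftyOf hγ₀
  -- locate `F` behind it
  obtain ⟨x₁, F₁, β₂, rfl, hF₁⟩ := hβ.recur (q₁ * E₁) β₁ (by rw [mul_smul, ← hβδ])
  rw [smul_mem_inftyOf, smul_mem_inftyOf] at hβ₁
  have hne₂ := hβ.nonempty_of_ne hC (q := q₁ * E₁ * x₁ * F₁) (γ := β₂)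
    (by rw [mul_smul, mul_smul, mul_smul, ← hβδ])
  -- and transfer this back to `α`
  rw [hβδ] at h'
  obtain ⟨q₂, δ₂, hαδ, h6, h7⟩ := hsplit _ _ _ _
    (smul_ne_fin_one (smul_ne_fin_one (smul_ne_fin_one hne₂))) h'
  obtain ⟨E₂, δ₃, rfl, h8, h9⟩ := hsplit _ _ _ _ (smul_ne_fin_one (smul_ne_fin_one hne₂)) h7
  obtain ⟨x₂, δ₄, rfl, h10, h11⟩ := hsplit _ _ _ _ (smul_ne_fin_one hne₂) h9
  obtain ⟨F₂, α₂, rfl, h12, h13⟩ := hsplit _ _ _ _ hne₂ h11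
  have hα₂ := h13.mem_inftyOf hβ₁.2.2
  obtain ⟨x₃, E₃, α₃, rfl, hE₃⟩ := hα.recur (q₂ * E₂ * x₂ * F₂) α₂
    (by rw [mul_smul, mul_smul, mul_smul, ← hαδ])
  rw [smul_mem_inftyOf, smul_mem_inftyOf] at hα₂
  have hx₂ : x₂ ∈ starOf C := fin_mem_inftyOf.1
    (h10.mem_inftyOf (fin_mem_inftyOf.2 hβ₁.1))
  have hEC : E ∈ starOf C := hα.alph_eq.le
  have hB := hα.mul_monLE (z := x₂ * F₂ * x₃) ((h2.mono hk).trans (h6.mono hk₃))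
    (h4.trans (h8.mono hk₂)) (monHom_eq_iff.1 hE₃).2 hα₂.2.2 (by
      simp only [mul_smul]
      exact hαδ)
  have hA := hα.monLE_mul hβ hkα hα₂.1
  have hA' := hβ.monLE_mul hα hkβ (mul_mem_starOf.2 ⟨hEC, hx₂⟩)
  have hF : MonLE k (Word.fin F) (Word.fin F₂) := (monHom_eq_iff.1 hF₁).2.trans h12
  -- The upper bound is `hA`. For the lower one, `v` lies below `u E x₂ F`, hence below `u E x₂ F₂`;
  -- multiplying by `x₃ E` and applying `hB` brings `v x₃ E` below `u`.
  refine ⟨x₃ * E, mul_mem_starOf.2 ⟨hα₂.1, hEC⟩, monHom_eq_iff.2 ⟨?_, MonLE.trans ?_ hB⟩⟩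
  · rwa [← mul_assoc]
  · have h14 := (hA'.trans ((MonLE.refl k (Word.fin (u * (E * x₂)))).mul hF)).mul
      (MonLE.refl k (Word.fin (x₃ * E)))
    simpa only [mul_assoc] using h14

end IsStable

/-! ### From the algebraic conditions to saturation -/

theorem pairLang_mono {M : Type v} {M' : Type w} [Monoid M] [Monoid M'] {g : FreeMonoid Γ →* M}
    {h : FreeMonoid Γ →* M'} (hgh : ∀ p q, g p = g q → h p = h q) (u E : FreeMonoid Γ) :
    pairLang g (g u) (g E) ⊆ pairLang h (h u) (h E) := by
  rintro _ ⟨p, hp, β, ⟨v, hv, hβ⟩, rfl⟩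
  exact ⟨p, hgh _ _ hp, β, ⟨v, fun i => hgh _ _ (hv i), hβ⟩, rfl⟩

theorem exists_monSaturated_of_algebraic [Finite Γ] {L : Set (Word Γ)} (hL : IsOmegaRegular L)
    (hV : InV2 (Synt L))
    (hpair : ∀ s e t f : Synt L, IsLinkedPair s e → IsLinkedPair t f →
      (∃ (C : Set Γ) (e' f' : FreeMonoid Γ),
        syntHom L e' = e ∧ syntHom L f' = f ∧ alph e' = C ∧ alph f' = C ∧
          (fun x => s * x) '' (syntHom L '' starOf C) =
            (fun x => t * x) '' (syntHom L '' starOf C)) →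
      (pairLang (syntHom L) s e ⊆ L ↔ pairLang (syntHom L) t f ⊆ L)) :
    ∃ n, MonSaturated n L := by
  obtain ⟨k, hk⟩ := hV.exists_monHom (syntHom L)
  choose S₀ hS₀ using MonLE.exists_split Γ
  -- The maximum ensures `n ≤ S n`, and `1 ≤ S n` so that finite words are recognized.
  let S : ℕ → ℕ := fun n => max (max 1 n) (S₀ n)
  have hS : ∀ n, n ≤ S n := fun n => (le_max_right 1 n).trans (le_max_left _ _)
  have hS1 : ∀ n, 1 ≤ S n := fun n => (le_max_left 1 n).trans (le_max_left _ _)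
  have hsplit : ∀ (n : ℕ) (p : FreeMonoid Γ) (γ β : Word Γ), γ ≠ Word.fin 1 →
      MonLE (S n) (p • γ) β →
      ∃ q δ, β = q • δ ∧ MonLE n (Word.fin p) (Word.fin q) ∧ MonLE n γ δ :=
    fun n p γ β hγ h => hS₀ n p γ β hγ (h.mono (le_max_right _ _))
  refine ⟨S (S (S (S k))), fun α β h h' hαL => ?_⟩
  obtain ⟨C, u, E, hα⟩ := exists_isStable k α
  obtain ⟨D, v, F, hβ⟩ := exists_isStable k β
  have hle : S k ≤ S (S (S (S k))) := ((hS _).trans (hS _)).trans (hS _)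
  obtain rfl : C = D := Set.Subset.antisymm
    (hβ.alph_subset hα (hS1 k) (hsplit k) (h'.mono hle))
    (hα.alph_subset hβ (hS1 k) (hsplit k) (h.mono hle))
  obtain ⟨x, hx, hux⟩ := hα.exists_monHom_eq hβ hS hsplit h h'
  obtain ⟨y, hy, hvy⟩ := hβ.exists_monHom_eq hα hS hsplit h' h
  have link : ∀ {γ : Word Γ} {p G : FreeMonoid Γ}, IsStable k C γ p G →
      IsLinkedPair (syntHom L p) (syntHom L G) := by
    intro γ p G hγ
    have h1 := hγ.idem
    have h2 := hγ.absorb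
    rw [← map_mul] at h1 h2
    exact ⟨by rw [← map_mul]; exact hk _ _ h1, by rw [← map_mul]; exact hk _ _ h2⟩
  have hsub : ∀ {p q x : FreeMonoid Γ}, x ∈ starOf C → monHom Γ k p = monHom Γ k (q * x) →
      (fun x => syntHom L p * x) '' (syntHom L '' starOf C) ⊆
        (fun x => syntHom L q * x) '' (syntHom L '' starOf C) := by
    rintro p q x hx hpq _ ⟨_, ⟨w, hw, rfl⟩, rfl⟩
    refine ⟨_, ⟨x * w, mul_mem_starOf.2 ⟨hx, hw⟩, rfl⟩, ?_⟩
    dsimp only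
    rw [hk _ _ hpq, map_mul, map_mul, mul_assoc]
  have hαp := pairLang_mono hk _ _ hα.mem_pairLang
  have hβp := pairLang_mono hk _ _ hβ.mem_pairLang
  refine (hpair _ _ _ _ (link hα) (link hβ) ⟨C, E, F, rfl, rfl, hα.alph_eq, hβ.alph_eq,
    Set.Subset.antisymm (hsub hx hux) (hsub hy hvy)⟩).1 ?_ hβp
  -- One word `α ∈ L` in the language of the linked pair forces the whole language into `L`.
  exact fun γ hγ => (hL.mem_iff_of_mem_pairLang (link hα) hαp hγ).1 hαL

end OmegaWords

/-! ### The main theorem -/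

open OmegaWords
theorem theorem2 {Γ : Type*} [Finite Γ] (L : Set (Word Γ)) (hL : IsOmegaRegular L) :
    List.TFAE
      [L ∈ monomialCombinations Γ,
        BSigma2Definable L,
        InV2 (Synt L) ∧
          ∀ s e t f : Synt L, IsLinkedPair s e → IsLinkedPair t f →
            (∃ (C : Set Γ) (e' f' : FreeMonoid Γ),
              syntHom L e' = e ∧ syntHom L f' = f ∧ alph e' = C ∧ alph f' = C ∧
                (fun x => s * x) '' (syntHom L '' starOf C) =
                  (fun x => t * x) '' (syntHom L '' starOf C)) →
            (pairLang (syntHom L) s e ⊆ L ↔ pairLang (syntHom L) t f ⊆ L)] := by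
  tfae_have 1 → 2 := bSigma2Definable_of_mem
  tfae_have 2 → 1 := fun h => by
    obtain ⟨n, hn⟩ := h.exists_monSaturated
    exact hn.mem_monomialCombinations
  tfae_have 1 → 3 := fun h => by
    obtain ⟨n, hn⟩ := exists_monSaturated h
    refine ⟨hn.inV2_synt, ?_⟩
    rintro s e t f hse htf ⟨C, e', f', he, hf, heC, hfC, hst⟩
    exact hn.pairLang_subset_iff hL hse htf he hf heC hfC hst
  tfae_have 3 → 1 := fun h => by
    obtain ⟨n, hn⟩ := exists_monSaturated_of_algebraic hL h.1 h.2
    exact hn.mem_monomialCombinations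
  tfae_finish
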